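/- For $a>0$, $\gamma>0$ and $t>0$ let $P^t_{a,\gamma}$ denote the Fourier multiplier operator on $\mathbb{R}$ $$P^t_{a,\gamma}f(x)=e^{i(t+it^\gamma)(-\Delta)^{a/2}}f(x)=\int_{\mathbb{R}}\hat f(\xi)\,e^{it|\xi|^a-t^\gamma|\xi|^a}\,e^{ix\xi}\,d\xi,\qquad \hat f(\xi)=\frac1{2\pi}\int_{\mathbb{R}}f(y)e^{-iy\xi}\,dy,$$ where for $f\in L^2(\mathbb{R})$ the transform $\hat f$ is that of Plancherel, and where for general $f\in L^p(\mathbb{R})$, $1\le p<\infty$, $P^t_{a,\gamma}f$ is understood as the convolution $K^t_{a,\gamma}*f$ with the kernel $K^t_{a,\gamma}(x)=\frac1{2\pi}\int_{\mathbb{R}}e^{it|\xi|^a-t^\gamma|\xi|^a}e^{ix\xi}\,d\xi$ (the two agree on $L^1(\mathbb R)$ and on $L^2(\mathbb{R})$). For $s>0$ let $H^s(\mathbb{R})=\{f\in L^2(\mathbb{R}):\int_{\mathbb{R}}(1+|\xi|^2)^s|\hat f(\xi)|^2\,d\xi<\infty\}$. **Corollary 1.2.** Let $0<a\le 1$. 1.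 If $0<\gamma\le 1$, $1\le p<\infty$ and $f\in L^p(\mathbb{R})$, then the integral defining $K^t_{a,\gamma}*f(x)$ converges absolutely for all $t>0$ and $x\in\mathbb{R}$, and $\lim_{t\to0^+}P^t_{a,\gamma}f(x)=f(x)$ for almost every $x\in\mathbb{R}$. 2. If $\gamma>1$ and $f\in H^s(\mathbb{R})$, where $s>\frac a4\left(1-\frac1\gamma\right)$ if $0<a<1$ and $s>\frac12\left(1-\frac1\gamma\right)$ if $a=1$, then the Fourier integral defining $P^t_{a,\gamma}f(x)$ converges absolutely for all $t>0$ and $x\in\mathbb{R}$, and $\lim_{t\to0^+}P^t_{a,\gamma}f(x)=f(x)$ for almost every $x\in\mathbb{R}$. -/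

import Mathlib

open MeasureTheory Filter Topology FourierTransform SchwartzMap
open scoped ENNReal

namespace FracSchrodinger

noncomputable section

/-- The Fourier multiplier `e^{it|ξ|^a - t^γ|ξ|^a}` of the fractional Schrödinger operator with
complex time `g(t) = t + i t^γ`, in terms of the angular frequency `ξ`. -/
def symbol (a γ t ξ : ℝ) : ℂ :=
  Complex.exp (Complex.I * ((t * |ξ| ^ a : ℝ) : ℂ) - ((t ^ γ * |ξ| ^ a : ℝ) : ℂ))

/-- The operator `P^t_{a,γ}` on `L²(ℝ)`, given by the Fourier integral of the symbol against the
(Plancherel) Fourier transform of `f`. Mathlib's Fourier transform integrates against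
`e^{-2πixξ}`, so that the frequency `ξ` there is the angular frequency `2πξ`. -/
def opL2 (a γ t : ℝ) (f : Lp ℂ 2 (volume : Measure ℝ)) (x : ℝ) : ℂ :=
  ∫ ξ : ℝ, (𝓕 f : Lp ℂ 2 (volume : Measure ℝ)) ξ * symbol a γ t (2 * Real.pi * ξ) *
    Complex.exp (2 * Real.pi * Complex.I * x * ξ)

/-- The convolution kernel of `P^t_{a,γ}`: the inverse Fourier transform of the symbol. -/
def kernel (a γ t x : ℝ) : ℂ :=
  ∫ ξ : ℝ, symbol a γ t (2 * Real.pi * ξ) * Complex.exp (2 * Real.pi * Complex.I * x * ξ)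

/-- The operator `P^t_{a,γ}` on functions that need not be in `L²(ℝ)`, as the convolution with its
kernel. It agrees with the Fourier integral on `L²(ℝ)` (`op_eq_opL2`) and on `L¹(ℝ)`
(`op_eq_of_integrable`). -/
def op (a γ t : ℝ) (f : ℝ → ℂ) (x : ℝ) : ℂ :=
  ∫ y : ℝ, kernel a γ t (x - y) * f y

end

section Agreement

lemma norm_symbol (a γ t ξ : ℝ) : ‖symbol a γ t ξ‖ = Real.exp (-(t ^ γ * |ξ| ^ a)) := by
  rw [symbol, Complex.norm_exp]
  congr 1
  simp only [Complex.sub_re, Complex.mul_re, Complex.I_re, Complex.I_im, Complex.ofReal_re,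
    Complex.ofReal_im]
  ring

lemma continuous_symbol {a : ℝ} (ha : 0 < a) (γ t : ℝ) : Continuous (symbol a γ t) := by
  have h : Continuous fun ξ : ℝ => |ξ| ^ a :=
    continuous_abs.rpow_const fun _ => Or.inr ha.le
  unfold symbol
  fun_prop

lemma integrable_exp_neg_abs_rpow {a b : ℝ} (ha : 0 < a) (hb : 0 < b) :
    Integrable fun ξ : ℝ => Real.exp (-(b * |ξ| ^ a)) := by
  have h1 : IntegrableOn (fun ξ : ℝ => Real.exp (-(b * |ξ| ^ a))) (Set.Ioi 0) := by
    have := integrableOn_rpow_mul_exp_neg_mul_rpow (s := 0) (by norm_num) ha hb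
    refine this.congr_fun (fun x hx => ?_) measurableSet_Ioi
    simp [abs_of_pos (show (0 : ℝ) < x from hx)]
  have h2 : IntegrableOn (fun ξ : ℝ => Real.exp (-(b * |ξ| ^ a))) (Set.Iic 0) := by
    rw [← Measure.map_neg_eq_self (volume : Measure ℝ)]
    let m : MeasurableEmbedding fun x : ℝ => -x := (Homeomorph.neg ℝ).measurableEmbedding
    rw [m.integrableOn_map_iff]
    simp_rw [Function.comp_def, abs_neg, Set.neg_preimage, Set.neg_Iic, neg_zero]
    exact Iff.mpr integrableOn_Ici_iff_integrableOn_Ioi h1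
  rw [← integrableOn_univ, ← Set.Iic_union_Ioi (a := (0 : ℝ))]
  exact h2.union h1

/-- The symbol times a character, as it occurs in the Fourier integral. -/
lemma symbol_wave {a γ t : ℝ} (ha : 0 < a) (ht : 0 < t) (x : ℝ) (p : ℝ≥0∞) (hp : p = 1 ∨ p = 2) :
    MemLp (fun ξ : ℝ => symbol a γ t (2 * Real.pi * ξ) *
      Complex.exp (2 * Real.pi * Complex.I * x * ξ)) p volume := by
  have hn : ∀ ξ : ℝ, ‖symbol a γ t (2 * Real.pi * ξ) *
      Complex.exp (2 * Real.pi * Complex.I * x * ξ)‖ =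
      Real.exp (-(t ^ γ * |2 * Real.pi * ξ| ^ a)) := by
    intro ξ
    rw [norm_mul, norm_symbol]
    have : (2 * Real.pi * Complex.I * x * ξ : ℂ) = ((2 * Real.pi * x * ξ : ℝ) : ℂ) * Complex.I := by
      push_cast; ring
    rw [this, Complex.norm_exp_ofReal_mul_I, mul_one]
  have hc : Continuous fun ξ : ℝ => symbol a γ t (2 * Real.pi * ξ) *
      Complex.exp (2 * Real.pi * Complex.I * x * ξ) := by
    have := continuous_symbol ha γ t
    fun_prop
  have htg : 0 < t ^ γ := Real.rpow_pos_of_pos ht γ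
  have h2pi : (2 * Real.pi) ≠ 0 := by positivity
  rcases hp with rfl | rfl
  · rw [memLp_one_iff_integrable, ← integrable_norm_iff hc.aestronglyMeasurable]
    simp only [hn]
    exact (integrable_exp_neg_abs_rpow ha htg).comp_mul_left' h2pi
  · rw [← integrable_norm_rpow_iff hc.aestronglyMeasurable (by norm_num) (by norm_num)]
    simp only [hn]
    have h := (integrable_exp_neg_abs_rpow ha (show 0 < 2 * t ^ γ by positivity)).comp_mul_left' h2pi
    refine h.congr (Eventually.of_forall fun ξ => ?_)
    simp only [ENNReal.toReal_ofNat]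
    rw [← Real.exp_mul]
    congr 1
    ring

lemma fourierInv_toLp_ae {g : ℝ → ℂ} (hg1 : Integrable g) (hg2 : MemLp g 2 volume) :
    ((𝓕⁻ (hg2.toLp g) : Lp ℂ 2 (volume : Measure ℝ)) : ℝ → ℂ) =ᵐ[volume] 𝓕⁻ g := by
  have hcont : Continuous (𝓕⁻ g) := by
    rw [Real.fourierInv_eq_fourier_comp_neg]
    exact VectorFourier.fourierIntegral_continuous Real.continuous_fourierChar
      continuous_inner hg1.comp_neg
  refine ae_eq_of_integral_contDiff_smul_eq ((Lp.memLp _).locallyIntegrable (by norm_num))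
    hcont.locallyIntegrable fun φ hφ hφc => ?_
  have hφ1 : HasCompactSupport (Complex.ofRealCLM ∘ φ) := hφc.comp_left rfl
  have hφ2 : ContDiff ℝ ((⊤ : ℕ∞) : WithTop ℕ∞) (Complex.ofRealCLM ∘ φ) := by fun_prop
  set ψ : 𝓢(ℝ, ℂ) := hφ1.toSchwartzMap hφ2 with hψ
  calc
    _ = Lp.toTemperedDistribution (𝓕⁻ (hg2.toLp g)) ψ := by
      simp [Lp.toTemperedDistribution_apply, hψ]
    _ = Lp.toTemperedDistribution (hg2.toLp g) (𝓕⁻ ψ) := by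
      rw [← Lp.fourierInv_toTemperedDistribution_eq]; rfl
    _ = ∫ x, (𝓕⁻ ψ) x • g x := by
      rw [Lp.toTemperedDistribution_apply]
      refine integral_congr_ae ?_
      filter_upwards [hg2.coeFn_toLp] with x hx
      rw [hx]
    _ = ∫ x, (𝓕 (ψ : ℝ → ℂ)) x • g (-x) := by
      rw [← integral_neg_eq_self]
      refine integral_congr_ae (Eventually.of_forall fun x => ?_)
      simp only [SchwartzMap.fourierInv_coe, Real.fourierInv_eq_fourier_neg, neg_neg]
    _ = ∫ x, ψ x • 𝓕 (fun y => g (-y)) x := by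
      simpa using! VectorFourier.integral_fourierIntegral_smul_eq_flip (L := innerₗ ℝ)
        Real.continuous_fourierChar continuous_inner ψ.integrable hg1.comp_neg
    _ = _ := by
      rw [Real.fourierInv_eq_fourier_comp_neg]
      simp [hψ]

open ComplexConjugate in
/-- On `L²(ℝ)` the convolution with the kernel is the Fourier integral. -/
theorem op_eq_opL2 {a γ t : ℝ} (ha : 0 < a) (ht : 0 < t) (f : Lp ℂ 2 (volume : Measure ℝ))
    (x : ℝ) : op a γ t f x = opL2 a γ t f x := by
  set u : ℝ → ℂ := fun ξ : ℝ => symbol a γ t (2 * Real.pi * ξ) *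
      Complex.exp (2 * Real.pi * Complex.I * x * ξ) with hu
  have hu1 : Integrable u := memLp_one_iff_integrable.1 (symbol_wave ha ht x 1 (Or.inl rfl))
  have hu2 : MemLp u 2 volume := symbol_wave ha ht x 2 (Or.inr rfl)
  have hv1 : Integrable (fun ξ => conj (u ξ)) :=
    (Complex.conjLIE.toContinuousLinearEquiv.toContinuousLinearMap.integrable_comp hu1 :)
  have hv2 : MemLp (fun ξ => conj (u ξ)) 2 volume := hu2.star
  have hker : ∀ y, 𝓕⁻ (fun ξ => conj (u ξ)) y = conj (kernel a γ t (x - y)) := by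
    intro y
    rw [Real.fourierInv_eq', kernel, ← integral_conj]
    refine integral_congr_ae (Eventually.of_forall fun ξ => ?_)
    simp only [hu, smul_eq_mul, map_mul, ← Complex.exp_conj]
    simp only [Complex.conj_I, Complex.conj_ofReal, map_ofNat]
    rw [mul_left_comm, ← Complex.exp_add]
    congr 2
    simp
    ring
  have h := Lp.inner_fourier_eq (𝓕⁻ (hv2.toLp _)) f
  rw [FourierTransform.fourier_fourierInv_eq] at h
  rw [L2.inner_def, L2.inner_def] at h
  rw [op, opL2]
  symm
  calc
    _ = ∫ ξ, inner ℂ ((hv2.toLp _ : Lp ℂ 2 volume) ξ) ((𝓕 f : Lp ℂ 2 (volume : Measure ℝ)) ξ) := by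
      refine integral_congr_ae ?_
      filter_upwards [hv2.coeFn_toLp] with ξ hξ
      rw [hξ]
      simp [hu]
      ring
    _ = _ := h
    _ = _ := by
      refine integral_congr_ae ?_
      filter_upwards [fourierInv_toLp_ae hv1 hv2] with y hy
      rw [hy, hker]
      simp [mul_comm]

/-- On `L¹(ℝ)` the convolution with the kernel is the Fourier integral. -/
theorem op_eq_of_integrable {a γ t : ℝ} (ha : 0 < a) (ht : 0 < t) {f : ℝ → ℂ} (hf : Integrable f)
    (x : ℝ) : op a γ t f x = ∫ ξ : ℝ, 𝓕 f ξ * symbol a γ t (2 * Real.pi * ξ) *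
      Complex.exp (2 * Real.pi * Complex.I * x * ξ) := by
  set u : ℝ → ℂ := fun ξ : ℝ => symbol a γ t (2 * Real.pi * ξ) *
      Complex.exp (2 * Real.pi * Complex.I * x * ξ) with hu
  have hu1 : Integrable u := memLp_one_iff_integrable.1 (symbol_wave ha ht x 1 (Or.inl rfl))
  have hker : ∀ y, 𝓕 u y = kernel a γ t (x - y) := by
    intro y
    rw [Real.fourier_eq', kernel]
    refine integral_congr_ae (Eventually.of_forall fun ξ => ?_)
    simp only [hu, smul_eq_mul]
    rw [mul_left_comm, ← Complex.exp_add]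
    congr 2
    simp
    ring
  have h : ∫ ξ, 𝓕 u ξ • f ξ = ∫ y, u y • 𝓕 f y := by
    simpa using! VectorFourier.integral_fourierIntegral_smul_eq_flip (L := innerₗ ℝ)
        Real.continuous_fourierChar continuous_inner hu1 hf
  simp only [hker, smul_eq_mul] at h
  rw [op, h]
  refine integral_congr_ae (Eventually.of_forall fun ξ => ?_)
  simp only [hu]
  ring

end Agreement

end FracSchrodinger

namespace FracSchrodinger

/-! ### Van der Corput estimates with a decreasing amplitude. -/

section VanDerCorput

open Set

/-! The two claims rest on different mechanisms, according to whether the damping `t^γ|ξ|^a`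
dominates the dispersion `t|ξ|^a` for small `t`.

For `γ ≤ 1` it does: with `z = t^γ - it` the symbol is `e^{-z|ξ|^a}`, and `|z| ≤ 2 Re z` when `t ≤
1`. Integration by parts gives a kernel of size `1/l` with decay `l^a|x|^{-1-a}` at the scale `l =
t^{γ/a}` (`exists_norm_kernel_le`). Its integral is 1, so it is an approximate identity and
converges at every Lebesgue point (`tendsto_approximate_identity`).

For `γ > 1` the dispersion wins and a maximal estimate is needed. Choose the time as a measurable
function of `x` and apply `TT*` on a frequency block `|η| ~ N`. The kernel of `TT*` has phase
`(x-x')η + (t-t')|η|^a` and damping at least `|t-t'|^γ|η|^a`. If the phase is not stationary, it is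
at most `N^ε|x-x'|^{ε-1}`. If it may be stationary, then `|t-t'|` is at least of order
`|x-x'|N^{1-a}`, and the damping becomes exponential decay in `|x-x'|^γ N^{γ(1-a)+a}`; for `a < 1`
curvature contributes a further factor `(N|x-x'|)^{-1/2}`. Either way the bound does not see the
times (`exists_norm_kernel_block_le`). Its integral over a bounded interval is `O(N^ε)`, with `ε =
a(1-1/γ)/2` for `a < 1` and `ε = 1-1/γ` for `a = 1`, and Schur's test gives a maximal inequality
with constant `O(N^ε)` for the squared norm (`exists_maximal_le`).

The Sobolev weight gains `N^{-2s}` on the block, and `ε < 2s` is exactly the hypothesis on `s`.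
Hence the blocks have, almost everywhere, a summable majorant uniform in time
(`ae_exists_summable_bound`); dominated convergence of the series and Fourier inversion at time zero
finish the proof. -/

lemma norm_cexp_I_mul (x : ℝ) : ‖Complex.exp (Complex.I * x)‖ = 1 := by
  rw [mul_comm]; exact Complex.norm_exp_ofReal_mul_I x

lemma antitoneOn_Icc_of_hasDerivAt {a b : ℝ} {ψ ψ' : ℝ → ℝ}
    (hψ : ∀ x ∈ Icc a b, HasDerivAt ψ (ψ' x) x) (hψ' : ∀ x ∈ Icc a b, ψ' x ≤ 0) :
    AntitoneOn ψ (Icc a b) := by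
  refine antitoneOn_of_deriv_nonpos (convex_Icc a b)
    (fun x hx => (hψ x hx).continuousAt.continuousWithinAt)
    (fun x hx => (hψ x (interior_subset hx)).differentiableAt.differentiableWithinAt)
    fun x hx => ?_
  rw [(hψ x (interior_subset hx)).deriv]
  exact hψ' x (interior_subset hx)

/-- The first derivative test of van der Corput, with a decreasing amplitude. -/
lemma norm_oscillatory_le_of_le_abs_deriv {a b l : ℝ} (hab : a ≤ b) (hl : 0 < l)
    {φ φ' φ'' ψ ψ' : ℝ → ℝ}
    (hφ : ∀ x ∈ Icc a b, HasDerivAt φ (φ' x) x) (hφ' : ∀ x ∈ Icc a b, HasDerivAt φ' (φ'' x) x)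
    (hφ'' : ContinuousOn φ'' (Icc a b)) (hconv : ∀ x ∈ Icc a b, 0 ≤ φ'' x)
    (hψ : ∀ x ∈ Icc a b, HasDerivAt ψ (ψ' x) x) (hψ' : ContinuousOn ψ' (Icc a b))
    (hψ0 : ∀ x ∈ Icc a b, 0 ≤ ψ x) (hψ'0 : ∀ x ∈ Icc a b, ψ' x ≤ 0)
    (hlb : ∀ x ∈ Icc a b, l ≤ |φ' x|) :
    ‖∫ x in a..b, (ψ x : ℂ) * Complex.exp (Complex.I * φ x)‖ ≤ 4 * ψ a / l := by
  have hu : uIcc a b = Icc a b := uIcc_of_le hab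
  have ha : a ∈ Icc a b := left_mem_Icc.2 hab
  have hb : b ∈ Icc a b := right_mem_Icc.2 hab
  have hanti := antitoneOn_Icc_of_hasDerivAt hψ hψ'0
  have hne : ∀ x ∈ Icc a b, φ' x ≠ 0 := fun x hx h => by
    have := hlb x hx; rw [h, abs_zero] at this; linarith
  have hcφ' : ContinuousOn φ' (Icc a b) := fun x hx => (hφ' x hx).continuousAt.continuousWithinAt
  have hcψ : ContinuousOn ψ (Icc a b) := fun x hx => (hψ x hx).continuousAt.continuousWithinAt
  have hcφ : ContinuousOn φ (Icc a b) := fun x hx => (hφ x hx).continuousAt.continuousWithinAt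
  set v' : ℝ → ℝ := fun x => (ψ' x * φ' x - ψ x * φ'' x) / φ' x ^ 2 with hv'
  have hv : ∀ x ∈ Icc a b, HasDerivAt (fun x => ψ x / φ' x) (v' x) x := fun x hx =>
    (hψ x hx).div (hφ' x hx) (hne x hx)
  have hcv' : ContinuousOn v' (Icc a b) :=
    ((hψ'.mul hcφ').sub (hcψ.mul hφ'')).div (hcφ'.pow 2) fun x hx => pow_ne_zero 2 (hne x hx)
  set V : ℝ → ℂ := fun x => -Complex.I * ((ψ x / φ' x : ℝ) : ℂ) with hV
  set E : ℝ → ℂ := fun x => Complex.exp (Complex.I * φ x) with hE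
  have hdV : ∀ x ∈ Icc a b, HasDerivAt V (-Complex.I * (v' x : ℂ)) x := fun x hx =>
    (hv x hx).ofReal_comp.const_mul _
  have hdE : ∀ x ∈ Icc a b, HasDerivAt E (E x * (Complex.I * φ' x)) x := fun x hx =>
    ((hφ x hx).ofReal_comp.const_mul _).cexp
  have hcE : ContinuousOn E (Icc a b) := fun x hx => (hdE x hx).continuousAt.continuousWithinAt
  have hibp := intervalIntegral.integral_mul_deriv_eq_deriv_mul (a := a) (b := b)
    (hu ▸ hdV) (hu ▸ hdE)
    (ContinuousOn.intervalIntegrable (by rw [hu]; fun_prop))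
    (ContinuousOn.intervalIntegrable (by rw [hu]; fun_prop))
  have hEn : ∀ x, ‖E x‖ = 1 := fun x => norm_cexp_I_mul _
  have hVn : ∀ x ∈ Icc a b, ‖V x‖ ≤ ψ x / l := fun x hx => by
    simp only [hV, norm_mul, norm_neg, Complex.norm_I, one_mul, Complex.norm_real, norm_div,
      Real.norm_eq_abs, abs_of_nonneg (hψ0 x hx)]
    exact div_le_div_of_nonneg_left (hψ0 x hx) hl (hlb x hx)
  have hinv : ∀ x ∈ Icc a b, |(φ' x)⁻¹| ≤ 1 / l := fun x hx => by
    rw [abs_inv, ← one_div]; exact one_div_le_one_div_of_le hl (hlb x hx)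
  -- As `ψ' ≤ 0 ≤ φ''`, the majorant of `|v'|` is an exact derivative and its integral telescopes.
  -- Adding the boundary terms, `ψ b / l` cancels and `4 * ψ a / l` remains.
  have hint : ‖∫ x in a..b, -Complex.I * (v' x : ℂ) * E x‖ ≤
      ∫ x in a..b, (-(ψ' x / l) + ψ a * (φ'' x / φ' x ^ 2)) := by
    refine intervalIntegral.norm_integral_le_of_norm_le hab (ae_of_all _ fun x hx => ?_) ?_
    · have hx' : x ∈ Icc a b := Ioc_subset_Icc_self hx
      rw [norm_mul, hEn, mul_one, norm_mul, norm_neg, Complex.norm_I, one_mul, Complex.norm_real,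
        Real.norm_eq_abs]
      have h1 : v' x = ψ' x / φ' x - ψ x * (φ'' x / φ' x ^ 2) := by
        have := hne x hx'
        simp only [hv']; field_simp
      rw [h1]
      refine (abs_sub _ _).trans (add_le_add ?_ ?_)
      · rw [abs_div, abs_of_nonpos (hψ'0 x hx'), ← neg_div]
        exact div_le_div_of_nonneg_left (by linarith [hψ'0 x hx']) hl (hlb x hx')
      · have h2 : 0 ≤ φ'' x / φ' x ^ 2 := div_nonneg (hconv x hx') (sq_nonneg _)
        rw [abs_of_nonneg (mul_nonneg (hψ0 x hx') h2)]
        exact mul_le_mul_of_nonneg_right (hanti ha hx' hx'.1) h2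
    · refine ContinuousOn.intervalIntegrable ?_
      rw [hu]
      exact ((hψ'.div_const l).neg).add (continuousOn_const.mul
        (hφ''.div (hcφ'.pow 2) fun x hx => pow_ne_zero 2 (hne x hx)))
  have hint2 : ∫ x in a..b, (-(ψ' x / l) + ψ a * (φ'' x / φ' x ^ 2)) =
      (-(ψ b / l) - ψ a * (φ' b)⁻¹) - (-(ψ a / l) - ψ a * (φ' a)⁻¹) := by
    refine intervalIntegral.integral_eq_sub_of_hasDerivAt
      (f := fun x => -(ψ x / l) - ψ a * (φ' x)⁻¹) (fun x hx => ?_) ?_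
    · rw [hu] at hx
      have := (((hψ x hx).div_const l).neg).sub (((hφ' x hx).inv (hne x hx)).const_mul (ψ a))
      convert! this using 1
      ring
    · refine ContinuousOn.intervalIntegrable ?_
      rw [hu]
      exact ((hψ'.div_const l).neg).add (continuousOn_const.mul
        (hφ''.div (hcφ'.pow 2) fun x hx => pow_ne_zero 2 (hne x hx)))
  have hEq : ∫ x in a..b, (ψ x : ℂ) * Complex.exp (Complex.I * φ x) =
      ∫ x in a..b, V x * (E x * (Complex.I * φ' x)) := by
    refine intervalIntegral.integral_congr fun x hx => ?_
    rw [hu] at hx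
    have := hne x hx
    simp only [hV, hE]
    push_cast
    have h3 : (φ' x : ℂ) ≠ 0 := by exact_mod_cast this
    field_simp
    rw [Complex.I_sq]; ring
  rw [hEq, hibp]
  have h1 : ‖V b * E b‖ ≤ ψ b / l := by rw [norm_mul, hEn, mul_one]; exact hVn b hb
  have h2 : ‖V a * E a‖ ≤ ψ a / l := by rw [norm_mul, hEn, mul_one]; exact hVn a ha
  have h3 := (norm_sub_le (V b * E b - V a * E a) (∫ x in a..b, -Complex.I * (v' x : ℂ) * E x))
  have h4 := norm_sub_le (V b * E b) (V a * E a)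
  have h5 : ψ a * (φ' a)⁻¹ ≤ ψ a * (1 / l) :=
    mul_le_mul_of_nonneg_left ((le_abs_self _).trans (hinv a ha)) (hψ0 a ha)
  have h6 : ψ a * (-(φ' b)⁻¹) ≤ ψ a * (1 / l) :=
    mul_le_mul_of_nonneg_left ((neg_le_abs _).trans (hinv b hb)) (hψ0 a ha)
  have h7 : ψ a * (1 / l) = ψ a / l := by ring
  have h8 : 4 * ψ a / l = 4 * (ψ a / l) := by ring
  rw [h8]
  rw [hint2] at hint
  linarith

/-- The second derivative test of van der Corput, with a decreasing amplitude. -/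
lemma norm_oscillatory_le_of_le_deriv2 {a b μ : ℝ} (hab : a ≤ b) (hμ : 0 < μ)
    {φ φ' φ'' ψ ψ' : ℝ → ℝ}
    (hφ : ∀ x ∈ Icc a b, HasDerivAt φ (φ' x) x) (hφ' : ∀ x ∈ Icc a b, HasDerivAt φ' (φ'' x) x)
    (hφ'' : ContinuousOn φ'' (Icc a b)) (hconv : ∀ x ∈ Icc a b, μ ≤ φ'' x)
    (hψ : ∀ x ∈ Icc a b, HasDerivAt ψ (ψ' x) x) (hψ' : ContinuousOn ψ' (Icc a b))
    (hψ0 : ∀ x ∈ Icc a b, 0 ≤ ψ x) (hψ'0 : ∀ x ∈ Icc a b, ψ' x ≤ 0) :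
    ‖∫ x in a..b, (ψ x : ℂ) * Complex.exp (Complex.I * φ x)‖ ≤ 10 * ψ a / √μ := by
  have ha : a ∈ Icc a b := left_mem_Icc.2 hab
  have hb : b ∈ Icc a b := right_mem_Icc.2 hab
  have hanti := antitoneOn_Icc_of_hasDerivAt hψ hψ'0
  have hcφ' : ContinuousOn φ' (Icc a b) := fun x hx => (hφ' x hx).continuousAt.continuousWithinAt
  have hcψ : ContinuousOn ψ (Icc a b) := fun x hx => (hψ x hx).continuousAt.continuousWithinAt
  have hcφ : ContinuousOn φ (Icc a b) := fun x hx => (hφ x hx).continuousAt.continuousWithinAt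
  have hgrow : ∀ x ∈ Icc a b, ∀ y ∈ Icc a b, x ≤ y → μ * (y - x) ≤ φ' y - φ' x := by
    refine (convex_Icc a b).mul_sub_le_image_sub_of_le_deriv hcφ'
      (fun x hx => (hφ' x (interior_subset hx)).differentiableAt.differentiableWithinAt)
      fun x hx => ?_
    rw [(hφ' x (interior_subset hx)).deriv]
    exact hconv x (interior_subset hx)
  -- `c` is the zero of the increasing function `φ'`, or the endpoint nearest to where a zero would
  -- lie.
  obtain ⟨c, hc, hc1, hc2⟩ : ∃ c ∈ Icc a b, (∀ x ∈ Icc a b, c < x → μ * (x - c) ≤ φ' x) ∧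
      (∀ x ∈ Icc a b, x < c → μ * (c - x) ≤ -φ' x) := by
    rcases le_total 0 (φ' a) with h | h
    · refine ⟨a, ha, fun x hx _ => ?_, fun x hx hxa => absurd hx.1 (not_le.2 hxa)⟩
      linarith [hgrow a ha x hx hx.1]
    rcases le_total (φ' b) 0 with h' | h'
    · refine ⟨b, hb, fun x hx hxb => absurd hx.2 (not_le.2 hxb), fun x hx _ => ?_⟩
      linarith [hgrow x hx b hb hx.2]
    · obtain ⟨c, hc, hc0⟩ := intermediate_value_Icc hab hcφ' ⟨h, h'⟩
      refine ⟨c, hc, fun x hx hcx => ?_, fun x hx hcx => ?_⟩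
      · linarith [hgrow c hc x hx hcx.le]
      · linarith [hgrow x hx c hc hcx.le]
  set r := √μ with hr
  have hr0 : 0 < r := Real.sqrt_pos.2 hμ
  have hrr : r * r = μ := Real.mul_self_sqrt hμ.le
  -- Outside the `d`-neighbourhood of `c` one has `|φ'| ≥ μ d = √μ`, so the first derivative test
  -- applies on each side; inside, the length `2d` suffices. The constants are `4 + 4 + 2 = 10`.
  set d := 1 / r with hd
  have hd0 : 0 < d := by positivity
  have hmd : μ * d = r := by rw [hd, ← hrr]; field_simp
  set p := max a (c - d) with hp
  set q := min b (c + d) with hq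
  have hap : a ≤ p := le_max_left _ _
  have hqb : q ≤ b := min_le_left _ _
  have hpc : p ≤ c := max_le hc.1 (by linarith)
  have hcq : c ≤ q := le_min hc.2 (by linarith)
  have hcont : ContinuousOn (fun x => (ψ x : ℂ) * Complex.exp (Complex.I * φ x)) (Icc a b) := by
    fun_prop
  have hii : ∀ x ∈ Icc a b, ∀ y ∈ Icc a b, x ≤ y →
      IntervalIntegrable (fun x => (ψ x : ℂ) * Complex.exp (Complex.I * φ x)) volume x y :=
    fun x hx y hy hxy => (hcont.mono (Icc_subset_Icc hx.1 hy.2)).intervalIntegrable_of_Icc hxy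
  have hpm : p ∈ Icc a b := ⟨hap, by linarith⟩
  have hqm : q ∈ Icc a b := ⟨by linarith, hqb⟩
  have hψa := hψ0 a ha
  have hB : ∀ x ∈ Icc a b, ∀ y ∈ Icc a b, x ≤ y → (∀ z ∈ Icc x y, r ≤ |φ' z|) →
      ‖∫ x in x..y, (ψ x : ℂ) * Complex.exp (Complex.I * φ x)‖ ≤ 4 * ψ a / r := by
    intro x hx y hy hxy h
    have hs : Icc x y ⊆ Icc a b := Icc_subset_Icc hx.1 hy.2
    refine (norm_oscillatory_le_of_le_abs_deriv hxy hr0 (fun z hz => hφ z (hs hz))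
      (fun z hz => hφ' z (hs hz)) (hφ''.mono hs) (fun z hz => hμ.le.trans (hconv z (hs hz)))
      (fun z hz => hψ z (hs hz)) (hψ'.mono hs) (fun z hz => hψ0 z (hs hz))
      (fun z hz => hψ'0 z (hs hz)) h).trans ?_
    gcongr
    exact hanti ha hx hx.1
  have h1 : ‖∫ x in a..p, (ψ x : ℂ) * Complex.exp (Complex.I * φ x)‖ ≤ 4 * ψ a / r := by
    rcases le_total (c - d) a with h | h
    · have : p = a := max_eq_left h
      rw [this, intervalIntegral.integral_same, norm_zero]; positivity
    · have hpe : p = c - d := max_eq_right h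
      refine hB a ha p hpm hap fun z hz => ?_
      have h3 := hc2 z ⟨hz.1, by linarith [hz.2]⟩ (by linarith [hz.2])
      have h4 : μ * d ≤ μ * (c - z) := by gcongr; linarith [hz.2]
      linarith [neg_le_abs (φ' z)]
  have h2 : ‖∫ x in q..b, (ψ x : ℂ) * Complex.exp (Complex.I * φ x)‖ ≤ 4 * ψ a / r := by
    rcases le_total b (c + d) with h | h
    · have : q = b := min_eq_left h
      rw [this, intervalIntegral.integral_same, norm_zero]; positivity
    · have hqe : q = c + d := min_eq_right h
      refine hB q hqm b hb hqb fun z hz => ?_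
      have h3 := hc1 z ⟨by linarith [hz.1, hc.1], hz.2⟩ (by linarith [hz.1])
      have h4 : μ * d ≤ μ * (z - c) := by gcongr; linarith [hz.1]
      linarith [le_abs_self (φ' z)]
  have h3 : ‖∫ x in p..q, (ψ x : ℂ) * Complex.exp (Complex.I * φ x)‖ ≤ ψ a * (2 * d) := by
    refine (intervalIntegral.norm_integral_le_of_norm_le_const (C := ψ a) fun x hx => ?_).trans ?_
    · rw [uIoc_of_le (hpc.trans hcq)] at hx
      have hx' : x ∈ Icc a b := ⟨by linarith [hx.1], by linarith [hx.2]⟩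
      rw [norm_mul, norm_cexp_I_mul, mul_one, Complex.norm_real, Real.norm_eq_abs,
        abs_of_nonneg (hψ0 x hx')]
      exact hanti ha hx' hx'.1
    · rw [abs_of_nonneg (by linarith)]
      have := le_max_right a (c - d)
      have := min_le_right b (c + d)
      gcongr
      linarith
  rw [← intervalIntegral.integral_add_adjacent_intervals (hii a ha p hpm hap)
    (hii p hpm b hb hpm.2), ← intervalIntegral.integral_add_adjacent_intervals
    (hii p hpm q hqm (hpc.trans hcq)) (hii q hqm b hb hqb)]
  have h4 := norm_add_le (∫ x in a..p, (ψ x : ℂ) * Complex.exp (Complex.I * φ x))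
    ((∫ x in p..q, (ψ x : ℂ) * Complex.exp (Complex.I * φ x)) +
      ∫ x in q..b, (ψ x : ℂ) * Complex.exp (Complex.I * φ x))
  have h5 := norm_add_le (∫ x in p..q, (ψ x : ℂ) * Complex.exp (Complex.I * φ x))
    (∫ x in q..b, (ψ x : ℂ) * Complex.exp (Complex.I * φ x))
  have h6 : ψ a * (2 * d) = 2 * (ψ a / r) := by rw [hd]; ring
  have h7 : 4 * ψ a / r = 4 * (ψ a / r) := by ring
  have h8 : 10 * ψ a / r = 10 * (ψ a / r) := by ring
  rw [h8]
  linarith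

/-- Complex conjugation of an oscillatory integral changes the sign of the phase. -/
lemma norm_oscillatory_neg {a b : ℝ} (φ ψ : ℝ → ℝ) :
    ‖∫ x in a..b, (ψ x : ℂ) * Complex.exp (Complex.I * ((-φ x : ℝ) : ℂ))‖ =
      ‖∫ x in a..b, (ψ x : ℂ) * Complex.exp (Complex.I * φ x)‖ := by
  rw [← Complex.norm_conj (∫ x in a..b, (ψ x : ℂ) * Complex.exp (Complex.I * φ x)),
    ← intervalIntegral.intervalIntegral_conj]
  congr 2
  ext x
  rw [map_mul, ← Complex.exp_conj, map_mul, Complex.conj_ofReal, Complex.conj_ofReal,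
    Complex.conj_I]
  push_cast
  ring_nf

end VanDerCorput


/-! ### Oscillatory integrals over a dyadic frequency block. -/

section DyadicKernel

open Set

/-- The oscillatory integral over a dyadic block, with damping factor `b`. -/
noncomputable def dyadicOsc (a b τ x N : ℝ) : ℂ :=
  ∫ η in N..(2 * N), ((Real.exp (-(b * η ^ a)) : ℝ) : ℂ) *
    Complex.exp (Complex.I * ((x * η + τ * η ^ a : ℝ) : ℂ))

lemma norm_dyadicOsc_neg (a b τ x N : ℝ) :
    ‖dyadicOsc a b (-τ) (-x) N‖ = ‖dyadicOsc a b τ x N‖ := by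
  rw [dyadicOsc, dyadicOsc, ← norm_oscillatory_neg]
  congr 2
  ext η
  congr 4
  ring

lemma norm_dyadicOsc_le_length {a b N : ℝ} (ha : 0 < a) (hb : 0 ≤ b) (hN : 0 < N) (τ x : ℝ) :
    ‖dyadicOsc a b τ x N‖ ≤ N * Real.exp (-(b * N ^ a)) := by
  rw [dyadicOsc]
  refine (intervalIntegral.norm_integral_le_of_norm_le_const
    (C := Real.exp (-(b * N ^ a))) fun η hη => ?_).trans_eq ?_
  · rw [uIoc_of_le (by linarith)] at hη
    rw [norm_mul, norm_cexp_I_mul, mul_one, Complex.norm_real, Real.norm_eq_abs, Real.abs_exp]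
    have := Real.rpow_le_rpow hN.le hη.1.le ha.le
    gcongr
  · rw [abs_of_nonneg (by linarith)]; ring

lemma hasDerivAt_damping {a b η : ℝ} (hη : 0 < η) :
    HasDerivAt (fun η : ℝ => Real.exp (-(b * η ^ a)))
      (Real.exp (-(b * η ^ a)) * -(b * (a * η ^ (a - 1)))) η :=
  (((Real.hasDerivAt_rpow_const (Or.inl hη.ne')).const_mul b).neg).exp

lemma hasDerivAt_phase {a τ x η : ℝ} (hη : 0 < η) :
    HasDerivAt (fun η : ℝ => x * η + τ * η ^ a) (x + τ * (a * η ^ (a - 1))) η := by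
  simpa using! ((hasDerivAt_id η).const_mul x).add
    ((Real.hasDerivAt_rpow_const (p := a) (Or.inl hη.ne')).const_mul τ)

lemma hasDerivAt_phase_deriv {a τ x η : ℝ} (hη : 0 < η) :
    HasDerivAt (fun η : ℝ => x + τ * (a * η ^ (a - 1)))
      (τ * (a * ((a - 1) * η ^ (a - 1 - 1)))) η := by
  simpa using (((Real.hasDerivAt_rpow_const (p := a - 1) (Or.inl hη.ne')).const_mul a).const_mul
    τ).const_add x

lemma continuousOn_rpow_Icc {N M : ℝ} (hN : 0 < N) (p : ℝ) :
    ContinuousOn (fun η : ℝ => η ^ p) (Icc N M) :=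
  continuousOn_id.rpow_const fun _ hη => Or.inl (hN.trans_le hη.1).ne'

/-- The nonstationary regime. -/
lemma norm_dyadicOsc_le_inv {a b τ x N : ℝ} (ha : 0 < a) (ha1 : a ≤ 1) (hb : 0 ≤ b) (hN : 0 < N)
    (hx : x ≠ 0) (h : 2 * (a * |τ| * N ^ (a - 1)) ≤ |x|) :
    ‖dyadicOsc a b τ x N‖ ≤ 8 / |x| := by
  -- The phase is convex only for `τ ≤ 0`, because `a ≤ 1`. Conjugation reverses the signs of `τ`
  -- and `x` together and leaves the norm alone.
  wlog hτ : τ ≤ 0 generalizing τ x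
  · have := this (τ := -τ) (x := -x) (neg_ne_zero.2 hx) (by simpa using h) (by linarith)
    rwa [norm_dyadicOsc_neg, abs_neg] at this
  have hx0 : 0 < |x| := abs_pos.2 hx
  have hpos : ∀ η ∈ Icc N (2 * N), 0 < η := fun η hη => hN.trans_le hη.1
  rw [dyadicOsc]
  refine (norm_oscillatory_le_of_le_abs_deriv (l := |x| / 2) (by linarith) (by positivity)
    (fun η hη => hasDerivAt_phase (hpos η hη)) (fun η hη => hasDerivAt_phase_deriv (hpos η hη))
    (continuousOn_const.mul (continuousOn_const.mul (continuousOn_const.mul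
      (continuousOn_rpow_Icc hN _)))) (fun η hη => ?_)
    (fun η hη => hasDerivAt_damping (hpos η hη)) ?_ (fun η hη => (Real.exp_pos _).le)
    (fun η hη => ?_) (fun η hη => ?_)).trans ?_
  · have := Real.rpow_nonneg (hpos η hη).le (a - 1 - 1)
    exact mul_nonneg_of_nonpos_of_nonpos hτ
      (mul_nonpos_of_nonneg_of_nonpos ha.le (mul_nonpos_of_nonpos_of_nonneg (by linarith) this))
  · have h1 := continuousOn_rpow_Icc (M := 2 * N) hN a
    have h2 := continuousOn_rpow_Icc (M := 2 * N) hN (a - 1)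
    fun_prop
  · have := Real.rpow_nonneg (hpos η hη).le (a - 1)
    exact mul_nonpos_of_nonneg_of_nonpos (Real.exp_pos _).le (by
      rw [neg_nonpos]; positivity)
  · have h1 : η ^ (a - 1) ≤ N ^ (a - 1) :=
      Real.rpow_le_rpow_of_nonpos hN hη.1 (by linarith)
    have h2 : |τ * (a * η ^ (a - 1))| ≤ a * |τ| * N ^ (a - 1) := by
      have := Real.rpow_nonneg (hpos η hη).le (a - 1)
      rw [abs_mul, abs_of_nonneg (mul_nonneg ha.le this)]
      calc _ = a * |τ| * η ^ (a - 1) := by ring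
        _ ≤ _ := by gcongr
    have h3 := abs_sub_abs_le_abs_add x (τ * (a * η ^ (a - 1)))
    linarith
  · have : Real.exp (-(b * N ^ a)) ≤ 1 := Real.exp_le_one_iff.2 (by
      have := Real.rpow_nonneg hN.le a
      rw [neg_nonpos]; positivity)
    rw [div_le_div_iff₀ (by positivity) hx0]
    nlinarith

/-- The stationary regime in the presence of curvature. -/
lemma norm_dyadicOsc_le_rpow {a b τ x N : ℝ} (ha : 0 < a) (ha1 : a < 1) (hb : 0 ≤ b) (hN : 0 < N)
    (hx : x ≠ 0) (h : |x| ≤ 2 * (a * |τ| * N ^ (a - 1))) :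
    ‖dyadicOsc a b τ x N‖ ≤
      10 / √((1 - a) * 2 ^ (a - 3)) * (N ^ (1 / 2 : ℝ) * |x| ^ (-(1 / 2) : ℝ)) *
        Real.exp (-(b * N ^ a)) := by
  wlog hτ : τ ≤ 0 generalizing τ x
  · have := this (τ := -τ) (x := -x) (neg_ne_zero.2 hx) (by simpa using h) (by linarith)
    rwa [norm_dyadicOsc_neg, abs_neg] at this
  have hx0 : 0 < |x| := abs_pos.2 hx
  have hpos : ∀ η ∈ Icc N (2 * N), 0 < η := fun η hη => hN.trans_le hη.1
  have hc : 0 < (1 - a) * 2 ^ (a - 3) := mul_pos (by linarith) (by positivity)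
  set c := (1 - a) * 2 ^ (a - 3) with hcdef
  rw [dyadicOsc]
  refine (norm_oscillatory_le_of_le_deriv2 (μ := c * (|x| / N)) (by linarith) (by positivity)
    (fun η hη => hasDerivAt_phase (hpos η hη)) (fun η hη => hasDerivAt_phase_deriv (hpos η hη))
    (continuousOn_const.mul (continuousOn_const.mul (continuousOn_const.mul
      (continuousOn_rpow_Icc hN _)))) (fun η hη => ?_)
    (fun η hη => hasDerivAt_damping (hpos η hη)) ?_ (fun η hη => (Real.exp_pos _).le)
    (fun η hη => ?_)).trans_eq ?_
  -- The exponent is negative, so the curvature is least at `2 * N`. There the hypothesis replaces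
  -- `a|τ|N^{a-1}` by `|x|/2`, which accounts for `2^{a-3} = 2^{a-2}/2`.
  · have h1 : (2 * N) ^ (a - 1 - 1) ≤ η ^ (a - 1 - 1) :=
      Real.rpow_le_rpow_of_nonpos (hpos η hη) hη.2 (by linarith)
    have h2 : |x| * (2 ^ (a - 3) / N) ≤ a * |τ| * (2 * N) ^ (a - 1 - 1) := by
      calc |x| * (2 ^ (a - 3) / N) ≤
          2 * (a * |τ| * N ^ (a - 1)) * (2 ^ (a - 3) / N) := by gcongr
        _ = a * |τ| * (2 * N) ^ (a - 1 - 1) := by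
          rw [Real.mul_rpow (by norm_num) hN.le, Real.rpow_sub_one hN.ne' (a - 1),
            show a - 1 - 1 = a - 3 + 1 by ring, Real.rpow_add_one (by norm_num)]
          ring
    calc c * (|x| / N) = (1 - a) * (|x| * (2 ^ (a - 3) / N)) := by rw [hcdef]; ring
      _ ≤ (1 - a) * (a * |τ| * (2 * N) ^ (a - 1 - 1)) := by
        apply mul_le_mul_of_nonneg_left h2 (by linarith)
      _ ≤ (1 - a) * (a * |τ| * η ^ (a - 1 - 1)) := by
        apply mul_le_mul_of_nonneg_left _ (by linarith)
        gcongr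
      _ = _ := by rw [abs_of_nonpos hτ]; ring
  · have h1 := continuousOn_rpow_Icc (M := 2 * N) hN a
    have h2 := continuousOn_rpow_Icc (M := 2 * N) hN (a - 1)
    fun_prop
  · have := Real.rpow_nonneg (hpos η hη).le (a - 1)
    exact mul_nonpos_of_nonneg_of_nonpos (Real.exp_pos _).le (by
      rw [neg_nonpos]; positivity)
  · rw [Real.sqrt_mul hc.le, Real.sqrt_div hx0.le, Real.sqrt_eq_rpow |x|, Real.sqrt_eq_rpow N,
      Real.rpow_neg hx0.le]
    have h1 : (0 : ℝ) < |x| ^ (1 / 2 : ℝ) := by positivity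
    have h2 : (0 : ℝ) < N ^ (1 / 2 : ℝ) := by positivity
    have h3 : 0 < √c := Real.sqrt_pos.2 hc
    field_simp

lemma min_le_rpow_mul_rpow {A B ε : ℝ} (hA : 0 < A) (hε0 : 0 ≤ ε) (hε1 : ε ≤ 1)
    {I : ℝ} (h0 : 0 ≤ I) (hIA : I ≤ A) (hIB : I ≤ B) : I ≤ A ^ ε * B ^ (1 - ε) := by
  calc I = I ^ ε * I ^ (1 - ε) := by
        rw [← Real.rpow_add' h0 (by simp)]; simp
    _ ≤ _ := by gcongr

/-- A majorant of the kernel on a dyadic block that does not depend on time. -/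
noncomputable def majorant (a γ q ε C N x : ℝ) : ℝ :=
  8 * N ^ ε * |x| ^ (ε - 1) +
    C * N ^ (1 + q) * (|x| ^ q * Real.exp (-(2 ^ (-γ) * N ^ (γ * (1 - a) + a)) * |x| ^ γ))

lemma majorant_nonneg {C N : ℝ} (hC : 0 ≤ C) (hN : 0 ≤ N) (a γ q ε x : ℝ) :
    0 ≤ majorant a γ q ε C N x := by
  unfold majorant; positivity

/-- This removes the time from the stationary regime: a stationary point forces `|τ| ≥
|x|N^{1-a}/2`, and since `b ≥ |τ|^γ` the damping turns into decay in space. -/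
lemma exp_damping_le {a b γ τ x N : ℝ} (ha1 : a ≤ 1) (hγ : 0 < γ) (hN : 0 < N)
    (hb : |τ| ^ γ ≤ b) (h : |x| ≤ 2 * (a * |τ| * N ^ (a - 1))) :
    Real.exp (-(b * N ^ a)) ≤
      Real.exp (-(2 ^ (-γ) * N ^ (γ * (1 - a) + a)) * |x| ^ γ) := by
  have h1 : |x| * N ^ (1 - a) / 2 ≤ |τ| := by
    have h2 : N ^ (a - 1) * N ^ (1 - a) = 1 := by
      rw [← Real.rpow_add hN]; simp
    have h3 : |x| * N ^ (1 - a) ≤ 2 * (a * |τ| * N ^ (a - 1)) * N ^ (1 - a) := by gcongr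
    have h4 : 2 * (a * |τ| * N ^ (a - 1)) * N ^ (1 - a) = 2 * (a * |τ|) := by
      rw [mul_assoc, mul_assoc (a * |τ|), h2, mul_one]
    have h5 : a * |τ| ≤ 1 * |τ| := by gcongr
    linarith
  have h2 : (|x| * N ^ (1 - a) / 2) ^ γ ≤ b := (Real.rpow_le_rpow (by positivity) h1 hγ.le).trans hb
  have h3 : (|x| * N ^ (1 - a) / 2) ^ γ * N ^ a =
      2 ^ (-γ) * N ^ (γ * (1 - a) + a) * |x| ^ γ := by
    rw [Real.div_rpow (by positivity) (by norm_num), Real.mul_rpow (by positivity) (by positivity),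
      ← Real.rpow_mul hN.le, Real.rpow_add hN, Real.rpow_neg (by norm_num), mul_comm (1 - a)]
    ring
  rw [neg_mul, ← h3]
  gcongr

/-- Each regime is absorbed by one summand of the majorant. The exponent `q` records the curvature:
`-1/2` from the second derivative test, and `0` for `a = 1`, where the phase is linear and only the
length of the block is available. In the nonstationary regime the bounds `N` and `8/|x|` are
interpolated, since `1/|x|` alone is not integrable at the origin. -/
lemma exists_norm_dyadicOsc_le {a : ℝ} (ha : 0 < a) (ha1 : a ≤ 1) :
    ∃ q C : ℝ, (a < 1 → q = -(1 / 2)) ∧ (a = 1 → q = 0) ∧ 0 ≤ C ∧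
      ∀ {b γ τ x N ε : ℝ}, 0 < γ → |τ| ^ γ ≤ b → 0 < N → x ≠ 0 → 0 ≤ ε → ε ≤ 1 →
        ‖dyadicOsc a b τ x N‖ ≤ majorant a γ q ε C N x := by
  obtain ⟨q, C, hq, hq', hC, H⟩ : ∃ q C : ℝ, (a < 1 → q = -(1 / 2)) ∧ (a = 1 → q = 0) ∧ 0 ≤ C ∧
      ∀ {b τ x N : ℝ}, 0 ≤ b → 0 < N → x ≠ 0 → |x| ≤ 2 * (a * |τ| * N ^ (a - 1)) →
        ‖dyadicOsc a b τ x N‖ ≤ C * (N ^ (1 + q) * |x| ^ q) * Real.exp (-(b * N ^ a)) := by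
    rcases ha1.lt_or_eq with h | h
    · refine ⟨-(1 / 2), 10 / √((1 - a) * 2 ^ (a - 3)), fun _ => rfl, fun h' => absurd h' h.ne,
        by positivity, fun hb hN hx hτ => ?_⟩
      have := norm_dyadicOsc_le_rpow ha h hb hN hx hτ
      rwa [show (1 : ℝ) + -(1 / 2) = 1 / 2 by norm_num]
    · refine ⟨0, 1, fun h' => absurd h h'.ne, fun _ => rfl, zero_le_one, fun hb hN hx hτ => ?_⟩
      simpa using norm_dyadicOsc_le_length ha hb hN _ _
  refine ⟨q, C, hq, hq', hC, ?_⟩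
  intro b γ τ x N ε hγ hb hN hx hε0 hε1
  have hb0 : 0 ≤ b := le_trans (by positivity) hb
  have hx0 : 0 < |x| := abs_pos.2 hx
  unfold majorant
  rcases le_total (2 * (a * |τ| * N ^ (a - 1))) |x| with h | h
  · have h1 := norm_dyadicOsc_le_inv (b := b) ha ha1 hb0 hN hx h
    have h2 : ‖dyadicOsc a b τ x N‖ ≤ N :=
      (norm_dyadicOsc_le_length ha hb0 hN τ x).trans (mul_le_of_le_one_right hN.le
        (Real.exp_le_one_iff.2 (by rw [neg_nonpos]; positivity)))
    have h3 := min_le_rpow_mul_rpow hN hε0 hε1 (norm_nonneg _) h2 h1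
    refine (h3.trans ?_).trans (le_add_of_nonneg_right (by positivity))
    rw [Real.div_rpow (by norm_num) hx0.le, show ε - 1 = -(1 - ε) by ring,
      Real.rpow_neg hx0.le, div_eq_mul_inv, ← mul_assoc]
    have : (8 : ℝ) ^ (1 - ε) ≤ 8 := by
      conv_rhs => rw [← Real.rpow_one 8]
      exact Real.rpow_le_rpow_of_exponent_le (by norm_num) (by linarith)
    rw [mul_comm 8 (N ^ ε)]
    gcongr
  · refine ((H hb0 hN hx h).trans ?_).trans (le_add_of_nonneg_left (by positivity))
    have := exp_damping_le ha1 hγ hN hb h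
    calc _ ≤ C * (N ^ (1 + q) * |x| ^ q) *
          Real.exp (-(2 ^ (-γ) * N ^ (γ * (1 - a) + a)) * |x| ^ γ) := by gcongr
      _ = _ := by ring

lemma integrable_comp_abs {f : ℝ → ℝ} (hf : IntegrableOn f (Ioi 0)) :
    Integrable fun x : ℝ => f |x| := by
  have h1 : IntegrableOn (fun x => f |x|) (Ioi 0) :=
    hf.congr_fun (fun x hx => by rw [abs_of_pos (show (0 : ℝ) < x from hx)]) measurableSet_Ioi
  have h2 : IntegrableOn (fun x => f |x|) (Iic 0) := by
    rw [← Measure.map_neg_eq_self (volume : Measure ℝ)]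
    let m : MeasurableEmbedding fun x : ℝ => -x := (Homeomorph.neg ℝ).measurableEmbedding
    rw [m.integrableOn_map_iff]
    simp_rw [Function.comp_def, abs_neg, neg_preimage, neg_Iic, neg_zero]
    exact Iff.mpr integrableOn_Ici_iff_integrableOn_Ioi h1
  rw [← integrableOn_univ, ← Iic_union_Ioi (a := (0 : ℝ))]
  exact h2.union h1

/-- The value of `ε` comes from scaling: the exponential summand integrates to a multiple of
`N^{1+q} B^{-(1+q)/γ}` with `B` of order `N^{γ(1-a)+a}`, which is `N^ε`. Only the power `|x|^{ε-1}`
needs the bounded interval; it is integrable at `0` because `ε > 0`. -/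
lemma exists_lintegral_majorant_le {a γ q ε : ℝ} (hγ : 0 < γ)
    (hq : -1 < q) (hε : ε = (1 + q) * (a * (1 - 1 / γ))) (hε0 : 0 < ε) {C : ℝ} (hC : 0 ≤ C)
    (R : ℝ) : ∃ C' : ℝ, 0 ≤ C' ∧ ∀ {N : ℝ}, 0 < N →
      ∫⁻ x in Icc (-R) R, ENNReal.ofReal (majorant a γ q ε C N x) ≤
        ENNReal.ofReal (C' * N ^ ε) := by
  set A := ∫ x in Icc (-R) R, |x| ^ (ε - 1) with hA
  have hA0 : 0 ≤ A := integral_nonneg fun x => by positivity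
  set G := (2 ^ (-γ) : ℝ) ^ (-(q + 1) / γ) * (1 / γ) * Real.Gamma ((q + 1) / γ) with hG
  have hG0 : 0 ≤ G := by
    have : 0 < Real.Gamma ((q + 1) / γ) := Real.Gamma_pos_of_pos (div_pos (by linarith) hγ)
    positivity
  refine ⟨8 * A + C * (2 * G), by positivity, fun {N} hN => ?_⟩
  have hB : 0 < 2 ^ (-γ) * N ^ (γ * (1 - a) + a) := by positivity
  have hI1 : IntegrableOn (fun x : ℝ => |x| ^ (ε - 1)) (Icc (-R) R) := by
    have h : IntegrableOn (fun x : ℝ => Set.indicator (Ioc 0 R) (fun x => x ^ (ε - 1)) x)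
        (Ioi 0) := by
      refine Integrable.integrableOn ?_
      rw [integrable_indicator_iff measurableSet_Ioc]
      rcases le_total 0 R with h | h
      · exact (intervalIntegrable_iff_integrableOn_Ioc_of_le h).1
          (intervalIntegral.intervalIntegrable_rpow' (by linarith))
      · rw [Ioc_eq_empty (by linarith)]; exact integrableOn_empty
    have h2 := (integrable_comp_abs h).integrableOn (s := Icc (-R) R)
    refine h2.congr_fun_ae ?_
    have h0 : ∀ᵐ x : ℝ ∂volume.restrict (Icc (-R) R), x ≠ 0 :=
      ae_restrict_of_ae (by simp [ae_iff, measure_singleton])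
    filter_upwards [h0, ae_restrict_mem measurableSet_Icc] with x hx0 hx
    rw [indicator_of_mem]
    exact ⟨abs_pos.2 hx0, abs_le.2 hx⟩
  have hI2 : Integrable (fun x : ℝ => |x| ^ q *
      Real.exp (-(2 ^ (-γ) * N ^ (γ * (1 - a) + a)) * |x| ^ γ)) :=
    integrable_comp_abs (integrableOn_rpow_mul_exp_neg_mul_rpow hq hγ hB)
  have hI : IntegrableOn (majorant a γ q ε C N) (Icc (-R) R) :=
    (hI1.const_mul _).add (hI2.integrableOn.const_mul _)
  rw [← ofReal_integral_eq_lintegral_ofReal hI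
    (ae_of_all _ fun x => majorant_nonneg hC hN.le a γ q ε x)]
  refine ENNReal.ofReal_le_ofReal ?_
  unfold majorant
  rw [integral_add (hI1.const_mul _) (hI2.integrableOn.const_mul _), integral_const_mul,
    integral_const_mul, add_mul]
  refine add_le_add (le_of_eq (by ring)) ?_
  have h1 : ∫ x in Icc (-R) R, |x| ^ q *
      Real.exp (-(2 ^ (-γ) * N ^ (γ * (1 - a) + a)) * |x| ^ γ) ≤
      2 * (G * N ^ (ε - (1 + q))) := by
    refine (setIntegral_le_integral hI2 (ae_of_all _ fun x => by positivity)).trans_eq ?_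
    rw [integral_comp_abs (f := fun x => x ^ q *
      Real.exp (-(2 ^ (-γ) * N ^ (γ * (1 - a) + a)) * x ^ γ)),
      integral_rpow_mul_exp_neg_mul_rpow hγ hq hB, Real.mul_rpow (by positivity) (by positivity),
      ← Real.rpow_mul hN.le (γ * (1 - a) + a)]
    have : (γ * (1 - a) + a) * (-(q + 1) / γ) = ε - (1 + q) := by
      rw [hε]; field_simp; ring
    rw [this, hG]
    ring
  calc _ ≤ C * N ^ (1 + q) * (2 * (G * N ^ (ε - (1 + q)))) := by gcongr
    _ = C * (2 * G) * (N ^ (1 + q) * N ^ (ε - (1 + q))) := by ring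
    _ = _ := by rw [← Real.rpow_add hN]; ring_nf

end DyadicKernel


/-! ### Schur's test and the `TT*` method. -/

section TTStar

open Set ComplexConjugate Function

lemma ENNReal_mul_le_sq_add_sq (x y : ℝ≥0∞) : x * y ≤ x ^ 2 + y ^ 2 := by
  rcases le_total x y with h | h
  · calc x * y ≤ y * y := by gcongr
      _ = y ^ 2 := (sq y).symm
      _ ≤ _ := le_add_self
  · calc x * y ≤ x * x := by gcongr
      _ = x ^ 2 := (sq x).symm
      _ ≤ _ := le_self_add

/-- Schur's test for a nonnegative kernel. -/
lemma lintegral_prod_mul_mul_le {X : Type*} [MeasurableSpace X] {μ : Measure X} [SFinite μ]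
    {g : X → ℝ≥0∞} (hg : Measurable g) {k : X × X → ℝ≥0∞} (hk : Measurable k) {M : ℝ≥0∞}
    (hM : ∀ x, ∫⁻ x', k (x, x') ∂μ ≤ M) (hM' : ∀ x', ∫⁻ x, k (x, x') ∂μ ≤ M) :
    ∫⁻ p, g p.1 * g p.2 * k p ∂μ.prod μ ≤ 2 * M * ∫⁻ x, g x ^ 2 ∂μ := by
  have h1 : ∫⁻ p, g p.1 ^ 2 * k p ∂μ.prod μ ≤ M * ∫⁻ x, g x ^ 2 ∂μ := by
    rw [lintegral_prod _ (by fun_prop), ← lintegral_const_mul _ (by fun_prop)]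
    refine lintegral_mono fun x => ?_
    change ∫⁻ x', g x ^ 2 * k (x, x') ∂μ ≤ _
    rw [lintegral_const_mul _ (by fun_prop), mul_comm]
    gcongr
    exact hM x
  have h2 : ∫⁻ p, g p.2 ^ 2 * k p ∂μ.prod μ ≤ M * ∫⁻ x, g x ^ 2 ∂μ := by
    rw [lintegral_prod_symm _ (by fun_prop), ← lintegral_const_mul _ (by fun_prop)]
    refine lintegral_mono fun x => ?_
    change ∫⁻ x', g x ^ 2 * k (x', x) ∂μ ≤ _
    rw [lintegral_const_mul _ (by fun_prop), mul_comm]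
    gcongr
    exact hM' x
  calc _ ≤ ∫⁻ p, (g p.1 ^ 2 * k p + g p.2 ^ 2 * k p) ∂μ.prod μ := by
        refine lintegral_mono fun p => ?_
        rw [← add_mul]
        gcongr
        exact ENNReal_mul_le_sq_add_sq _ _
    _ = (∫⁻ p, g p.1 ^ 2 * k p ∂μ.prod μ) + ∫⁻ p, g p.2 ^ 2 * k p ∂μ.prod μ :=
        lintegral_add_left (by fun_prop) _
    _ ≤ M * (∫⁻ x, g x ^ 2 ∂μ) + M * ∫⁻ x, g x ^ 2 ∂μ := add_le_add h1 h2
    _ = _ := by ring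

lemma enorm_integral_mul_le {Y : Type*} [MeasurableSpace Y] {ν : Measure Y} {f g : Y → ℂ}
    (hf : AEMeasurable f ν) (hg : AEMeasurable g ν) :
    ‖∫ y, f y * g y ∂ν‖ₑ ^ 2 ≤ (∫⁻ y, ‖f y‖ₑ ^ 2 ∂ν) * ∫⁻ y, ‖g y‖ₑ ^ 2 ∂ν := by
  have h1 : ‖∫ y, f y * g y ∂ν‖ₑ ≤ (∫⁻ y, ‖f y‖ₑ ^ (2 : ℝ) ∂ν) ^ (1 / 2 : ℝ) *
      (∫⁻ y, ‖g y‖ₑ ^ (2 : ℝ) ∂ν) ^ (1 / 2 : ℝ) := by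
    refine (enorm_integral_le_lintegral_enorm _).trans ?_
    simp_rw [enorm_mul]
    exact ENNReal.lintegral_mul_le_Lp_mul_Lq ν Real.HolderConjugate.two_two hf.enorm hg.enorm
  calc _ ≤ ((∫⁻ y, ‖f y‖ₑ ^ (2 : ℝ) ∂ν) ^ (1 / 2 : ℝ) *
      (∫⁻ y, ‖g y‖ₑ ^ (2 : ℝ) ∂ν) ^ (1 / 2 : ℝ)) ^ 2 := by gcongr
    _ = _ := by
      rw [mul_pow, ← ENNReal.rpow_mul_natCast, ← ENNReal.rpow_mul_natCast]
      norm_num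

lemma enorm_integral_conj_mul_self {X : Type*} [MeasurableSpace X] {μ : Measure X} {F : X → ℂ}
    (hF : Integrable (fun x => ‖F x‖ ^ 2) μ) :
    ‖∫ x, conj (F x) * F x ∂μ‖ₑ = ∫⁻ x, ‖F x‖ₑ ^ 2 ∂μ := by
  have h : ∫ x, conj (F x) * F x ∂μ = ((∫ x, ‖F x‖ ^ 2 ∂μ : ℝ) : ℂ) := by
    rw [← integral_complex_ofReal]
    congr 1 with x
    rw [Complex.conj_mul']; norm_cast
  have h0 : 0 ≤ ∫ x, ‖F x‖ ^ 2 ∂μ := integral_nonneg fun x => by positivity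
  rw [h, ← ofReal_norm, Complex.norm_real, Real.norm_of_nonneg h0,
    ofReal_integral_eq_lintegral_ofReal hF (ae_of_all _ fun x => by positivity)]
  refine lintegral_congr fun x => ?_
  rw [ENNReal.ofReal_pow (norm_nonneg _), ofReal_norm]

/-- The `TT*` argument: a bound for `T T*` gives a bound for `T`. -/
lemma lintegral_sq_le_of_kernel_le {X Y : Type*} [MeasurableSpace X] [MeasurableSpace Y]
    {μ : Measure X} [IsFiniteMeasure μ] {ν : Measure Y} [IsFiniteMeasure ν] {u : X × Y → ℂ}
    (hu : Measurable u) (hu1 : ∀ p, ‖u p‖ ≤ 1) {h : Y → ℂ} (hh : MemLp h 2 ν)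
    (hhm : Measurable h) {k : X × X → ℝ≥0∞} (hk : Measurable k)
    (hK : ∀ᵐ x ∂μ, ∀ᵐ x' ∂μ, ‖∫ y, u (x, y) * conj (u (x', y)) ∂ν‖ₑ ≤ k (x, x')) {M : ℝ≥0∞}
    (hM : ∀ x, ∫⁻ x', k (x, x') ∂μ ≤ M) (hM' : ∀ x', ∫⁻ x, k (x, x') ∂μ ≤ M) :
    ∫⁻ x, ‖∫ y, h y * u (x, y) ∂ν‖ₑ ^ 2 ∂μ ≤ 2 * M * ∫⁻ y, ‖h y‖ₑ ^ 2 ∂ν := by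
  have hh1 : Integrable h ν := hh.integrable (by norm_num)
  set F : X → ℂ := fun x => ∫ y, h y * u (x, y) ∂ν with hF
  set B := ∫ y, ‖h y‖ ∂ν with hB
  have hB0 : 0 ≤ B := integral_nonneg fun y => norm_nonneg _
  have hFm : Measurable F := by
    refine StronglyMeasurable.measurable ?_
    exact StronglyMeasurable.integral_prod_right' (f := fun p : X × Y => h p.2 * u p)
      (Measurable.stronglyMeasurable (by fun_prop))
  have hFB : ∀ x, ‖F x‖ ≤ B := fun x => by
    refine norm_integral_le_of_norm_le hh1.norm (ae_of_all _ fun y => ?_)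
    rw [norm_mul]
    exact mul_le_of_le_one_right (norm_nonneg _) (hu1 _)
  have hF2 : Integrable (fun x => ‖F x‖ ^ 2) μ := by
    refine Integrable.of_bound (by fun_prop) (B ^ 2) (ae_of_all _ fun x => ?_)
    rw [Real.norm_of_nonneg (by positivity)]
    gcongr
    exact hFB x
  -- Duality, with `F` tested against itself: `G` below is, up to conjugation, the adjoint applied
  -- to `F`.
  set w : X → ℂ := fun x => conj (F x) with hw
  have hwm : Measurable w := by fun_prop
  have hwB : ∀ x, ‖w x‖ ≤ B := fun x => by rw [hw, Complex.norm_conj]; exact hFB x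
  set G : Y → ℂ := fun y => ∫ x, w x * u (x, y) ∂μ with hG
  have hGm : Measurable G := by
    refine StronglyMeasurable.measurable ?_
    exact StronglyMeasurable.integral_prod_left' (f := fun p : X × Y => w p.1 * u p)
      (Measurable.stronglyMeasurable (by fun_prop))
  have hGB : ∀ y, ‖G y‖ ≤ B * μ.real univ := fun y => by
    refine norm_integral_le_of_norm_le_const (ae_of_all _ fun x => ?_)
    rw [norm_mul]
    exact mul_le_of_le_one_right (norm_nonneg _) (hu1 _) |>.trans (hwB x)
  have hG2 : Integrable (fun y => ‖G y‖ ^ 2) ν := by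
    refine Integrable.of_bound (by fun_prop) ((B * μ.real univ) ^ 2) (ae_of_all _ fun x => ?_)
    rw [Real.norm_of_nonneg (by positivity)]
    gcongr
    exact hGB x
  set A := ∫⁻ x, ‖F x‖ₑ ^ 2 ∂μ with hA
  -- Finiteness is what permits cancelling a factor `A` at the end; it comes from the boundedness of
  -- `u` and the finite measures.
  have hAtop : A ≠ ∞ := by
    have := hF2.lintegral_lt_top
    refine ne_of_lt (lt_of_eq_of_lt (lintegral_congr fun x => ?_) this)
    rw [ENNReal.ofReal_pow (norm_nonneg _), ofReal_norm]
  have hpair : ∫ x, conj (F x) * F x ∂μ = ∫ y, h y * G y ∂ν := by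
    have hint : Integrable (fun p : X × Y => w p.1 * (h p.2 * u p)) (μ.prod ν) := by
      refine Integrable.mono' (((integrable_const (μ := μ) B)).mul_prod hh1.norm)
        (Measurable.aestronglyMeasurable (by fun_prop)) (ae_of_all _ fun p => ?_)
      rw [norm_mul, norm_mul]
      have h1 := mul_le_of_le_one_right (norm_nonneg (h p.2)) (hu1 p)
      exact mul_le_mul (hwB p.1) h1 (by positivity) hB0
    calc _ = ∫ x, ∫ y, w x * (h y * u (x, y)) ∂ν ∂μ := by
          refine integral_congr_ae (ae_of_all _ fun x => ?_)
          simp only [hF, hw]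
          rw [integral_const_mul]
      _ = ∫ y, ∫ x, w x * (h y * u (x, y)) ∂μ ∂ν := integral_integral_swap hint
      _ = _ := by
          refine integral_congr_ae (ae_of_all _ fun y => ?_)
          simp only [hG]
          rw [← integral_const_mul]
          congr 1 with x
          ring
  have hA1 : A ^ 2 ≤ (∫⁻ y, ‖h y‖ₑ ^ 2 ∂ν) * ∫⁻ y, ‖G y‖ₑ ^ 2 ∂ν := by
    rw [hA, ← enorm_integral_conj_mul_self hF2, hpair]
    exact enorm_integral_mul_le hhm.aemeasurable hGm.aemeasurable
  -- Expanding the square and integrating in `y` first exposes the kernel of `TT*`, to which Schur's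
  -- test applies.
  have hG1 : ∫⁻ y, ‖G y‖ₑ ^ 2 ∂ν ≤ 2 * M * A := by
    have hexp : ∫ y, conj (G y) * G y ∂ν =
        ∫ p : X × X, w p.1 * conj (w p.2) *
          (∫ y, u (p.1, y) * conj (u (p.2, y)) ∂ν) ∂μ.prod μ := by
      have hint : Integrable (fun z : Y × (X × X) => w z.2.1 * conj (w z.2.2) *
          (u (z.2.1, z.1) * conj (u (z.2.2, z.1)))) (ν.prod (μ.prod μ)) := by
        refine Integrable.of_bound (Measurable.aestronglyMeasurable (by fun_prop)) (B * B * 1)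
          (ae_of_all _ fun z => ?_)
        simp only [norm_mul, Complex.norm_conj]
        gcongr
        · exact hwB _
        · exact hwB _
        · exact mul_le_one₀ (hu1 _) (norm_nonneg _) (hu1 _)
      calc _ = ∫ y, ∫ p : X × X, w p.1 * conj (w p.2) *
          (u (p.1, y) * conj (u (p.2, y))) ∂μ.prod μ ∂ν := by
            refine integral_congr_ae (ae_of_all _ fun y => ?_)
            simp only [hG]
            rw [← integral_conj, mul_comm, ← integral_prod_mul]
            congr 1 with p
            rw [map_mul]; ring
        _ = ∫ p : X × X, ∫ y, w p.1 * conj (w p.2) *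
          (u (p.1, y) * conj (u (p.2, y))) ∂ν ∂μ.prod μ := integral_integral_swap hint
        _ = _ := by
            refine integral_congr_ae (ae_of_all _ fun p => ?_)
            exact integral_const_mul _ _
    rw [← enorm_integral_conj_mul_self hG2, hexp]
    refine (enorm_integral_le_lintegral_enorm _).trans ?_
    have hKm : Measurable fun p : X × X => ∫ y, u (p.1, y) * conj (u (p.2, y)) ∂ν := by
      refine StronglyMeasurable.measurable ?_
      exact StronglyMeasurable.integral_prod_right'
        (f := fun z : (X × X) × Y => u (z.1.1, z.2) * conj (u (z.1.2, z.2)))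
        (Measurable.stronglyMeasurable (by fun_prop))
    have hmm : Measurable fun p : X × X => w p.1 * conj (w p.2) *
        ∫ y, u (p.1, y) * conj (u (p.2, y)) ∂ν := ((hwm.comp (measurable_fst (β := X))).mul
      (Complex.continuous_conj.measurable.comp (hwm.comp (measurable_snd (α := X))))).mul hKm
    have hmm' : Measurable fun p : X × X => ‖F p.1‖ₑ * ‖F p.2‖ₑ * k p :=
      ((hFm.comp measurable_fst).enorm.mul (hFm.comp measurable_snd).enorm).mul hk
    calc _ ≤ ∫⁻ p : X × X, ‖F p.1‖ₑ * ‖F p.2‖ₑ * k p ∂μ.prod μ := by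
          rw [lintegral_prod _ hmm.enorm.aemeasurable, lintegral_prod _ hmm'.aemeasurable]
          refine lintegral_mono_ae ?_
          filter_upwards [hK] with x hx
          refine lintegral_mono_ae ?_
          filter_upwards [hx] with x' hx'
          simp only [enorm_mul, hw]
          have : ∀ z : ℂ, ‖conj z‖ₑ = ‖z‖ₑ := fun z => by
            rw [← ofReal_norm, Complex.norm_conj, ofReal_norm]
          rw [this, this, this]
          gcongr
      _ ≤ _ := lintegral_prod_mul_mul_le hFm.enorm hk hM hM'
  have hA2 : A * A ≤ (2 * M * ∫⁻ y, ‖h y‖ₑ ^ 2 ∂ν) * A := by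
    calc A * A = A ^ 2 := (sq A).symm
      _ ≤ (∫⁻ y, ‖h y‖ₑ ^ 2 ∂ν) * (2 * M * A) := hA1.trans (by gcongr)
      _ = _ := by ring
  rcases eq_or_ne A 0 with h0 | h0
  · rw [h0]; exact zero_le
  · exact (ENNReal.mul_le_mul_iff_left h0 hAtop).1 hA2

end TTStar


/-! ### The maximal inequality on a dyadic block. -/

section Maximal

open Set ComplexConjugate

/-- The dyadic frequency block `N ≤ |2πξ| < 2N`. -/
def block (N : ℝ) : Set ℝ := {ξ | N ≤ |2 * Real.pi * ξ| ∧ |2 * Real.pi * ξ| < 2 * N}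

lemma measurableSet_block (N : ℝ) : MeasurableSet (block N) := by
  have h : Measurable fun ξ : ℝ => |2 * Real.pi * ξ| := by fun_prop
  exact (measurableSet_le measurable_const h).inter (measurableSet_lt h measurable_const)

lemma volume_abs_lt_lt_top (R : ℝ) : volume {ξ : ℝ | |2 * Real.pi * ξ| < R} < ∞ := by
  refine (measure_mono fun ξ hξ => ?_).trans_lt
    (measure_Icc_lt_top (a := -R) (b := R))
  have h1 : |2 * Real.pi * ξ| < R := hξ
  have h2 : |ξ| ≤ |2 * Real.pi * ξ| := by
    rw [abs_mul, abs_of_pos Real.two_pi_pos]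
    have := Real.pi_gt_three
    nlinarith [abs_nonneg ξ]
  exact abs_le.1 (h2.trans h1.le)

lemma volume_block_lt_top (N : ℝ) : volume (block N) < ∞ :=
  (measure_mono fun _ hξ => hξ.2).trans_lt (volume_abs_lt_lt_top (2 * N))

/-- The change of variable `η = 2πξ` costs `1/(2π) ≤ 1/2`. The factor `1/2` makes the two signs of
the frequency count as an average, so a bound common to both halves passes to the block without
loss. -/
lemma norm_setIntegral_block_le {N : ℝ} (hN : 0 < N) {g : ℝ → ℂ} (hg : Continuous g) :
    ‖∫ ξ in block N, g (2 * Real.pi * ξ)‖ ≤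
      (‖∫ η in N..(2 * N), g η‖ + ‖∫ η in N..(2 * N), g (-η)‖) / 2 := by
  set S : Set ℝ := Ico N (2 * N) ∪ Ioc (-(2 * N)) (-N) with hS
  have hSm : MeasurableSet S := measurableSet_Ico.union measurableSet_Ioc
  have hblock : ∀ ξ, (block N).indicator (fun ξ => g (2 * Real.pi * ξ)) ξ =
      S.indicator g (2 * Real.pi * ξ) := by
    intro ξ
    have : ξ ∈ block N ↔ 2 * Real.pi * ξ ∈ S := by
      generalize hz : 2 * Real.pi * ξ = z
      simp only [block, hz, mem_ofPred_eq, hS, mem_union, mem_Ico, mem_Ioc]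
      rcases le_total 0 z with h | h
      · rw [abs_of_nonneg h]
        constructor
        · exact fun h => Or.inl h
        · rintro (h' | h')
          · exact h'
          · linarith [h'.2]
      · rw [abs_of_nonpos h]
        constructor
        · exact fun h => Or.inr ⟨by linarith [h.2], by linarith [h.1]⟩
        · rintro (h' | h')
          · linarith [h'.1]
          · exact ⟨by linarith [h'.2], by linarith [h'.1]⟩
    by_cases h : ξ ∈ block N
    · rw [indicator_of_mem h, indicator_of_mem (this.1 h)]
    · rw [indicator_of_notMem h, indicator_of_notMem (fun h' => h (this.2 h'))]
  have hd : Disjoint (Ico N (2 * N)) (Ioc (-(2 * N)) (-N)) := by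
    rw [Set.disjoint_left]
    rintro z hz hz'
    linarith [hz.1, hz'.2]
  rw [← integral_indicator (measurableSet_block N)]
  simp_rw [hblock]
  rw [Measure.integral_comp_mul_left (fun η => S.indicator g η), integral_indicator hSm,
    setIntegral_union hd measurableSet_Ioc (hg.integrableOn_Icc.mono_set Ico_subset_Icc_self)
      (hg.integrableOn_Icc.mono_set Ioc_subset_Icc_self),
    integral_Ico_eq_integral_Ioc, ← intervalIntegral.integral_of_le (by linarith),
    ← intervalIntegral.integral_of_le (by linarith), intervalIntegral.integral_comp_neg,
    norm_smul, Real.norm_eq_abs, abs_abs, abs_of_pos (inv_pos.2 Real.two_pi_pos)]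
  have h1 := norm_add_le (∫ η in N..(2 * N), g η) (∫ η in -(2 * N)..-N, g η)
  have h2 : (2 * Real.pi)⁻¹ ≤ 1 / 2 := by
    rw [← one_div]
    exact one_div_le_one_div_of_le (by norm_num) (by linarith [Real.pi_gt_three])
  calc _ ≤ 1 / 2 * (‖∫ η in N..(2 * N), g η‖ + ‖∫ η in -(2 * N)..-N, g η‖) := by gcongr
    _ = _ := by ring

/-- In `TT*` the phases subtract while the dampings add. -/
lemma symbol_mul_conj_symbol {a γ t t' η : ℝ} :
    symbol a γ t η * conj (symbol a γ t' η) =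
      ((Real.exp (-((t ^ γ + t' ^ γ) * |η| ^ a)) : ℝ) : ℂ) *
        Complex.exp (Complex.I * (((t - t') * |η| ^ a : ℝ) : ℂ)) := by
  unfold symbol
  rw [← Complex.exp_conj, ← Complex.exp_add, Complex.ofReal_exp, ← Complex.exp_add]
  congr 1
  simp only [map_sub, map_mul, Complex.conj_I, Complex.conj_ofReal]
  push_cast
  ring

/-- A wave with the symbol as its amplitude. -/
noncomputable def wave (a γ t x ξ : ℝ) : ℂ :=
  symbol a γ t (2 * Real.pi * ξ) * Complex.exp (2 * Real.pi * Complex.I * x * ξ)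

lemma norm_wave_le (a γ : ℝ) {t : ℝ} (ht : 0 ≤ t) (x ξ : ℝ) : ‖wave a γ t x ξ‖ ≤ 1 := by
  have : (2 * Real.pi * Complex.I * x * ξ : ℂ) = ((2 * Real.pi * x * ξ : ℝ) : ℂ) * Complex.I := by
    push_cast; ring
  rw [wave, norm_mul, norm_symbol, this, Complex.norm_exp_ofReal_mul_I, mul_one,
    Real.exp_le_one_iff, neg_nonpos]
  positivity

/-- Since `t^γ + t'^γ ≥ |t-t'|^γ`, the damping controls the time difference in the phase. The right
side is free of `t` and `t'`, so the times may later depend on `x` and `x'` arbitrarily. Negative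
frequencies amount to `x - x'` with the opposite sign, and the majorant is even. -/
lemma exists_norm_kernel_block_le {a : ℝ} (ha : 0 < a) (ha1 : a ≤ 1) :
    ∃ q C : ℝ, (a < 1 → q = -(1 / 2)) ∧ (a = 1 → q = 0) ∧ 0 ≤ C ∧
      ∀ {γ t t' x x' N ε : ℝ}, 0 < γ → 0 ≤ t → 0 ≤ t' → 0 < N → x ≠ x' → 0 ≤ ε → ε ≤ 1 →
        ‖∫ ξ in block N, wave a γ t x ξ * conj (wave a γ t' x' ξ)‖ ≤
          majorant a γ q ε C N (x - x') := by
  obtain ⟨q, C, hq, hq', hC, H⟩ := exists_norm_dyadicOsc_le ha ha1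
  refine ⟨q, C, hq, hq', hC, ?_⟩
  intro γ t t' x x' N ε hγ ht ht' hN hx hε0 hε1
  have hb : |t - t'| ^ γ ≤ t ^ γ + t' ^ γ := by
    have h1 : 0 ≤ t ^ γ := by positivity
    have h2 : 0 ≤ t' ^ γ := by positivity
    rcases le_total t' t with h | h
    · rw [abs_of_nonneg (by linarith)]
      have := Real.rpow_le_rpow (by linarith) (show t - t' ≤ t by linarith) hγ.le
      linarith
    · rw [abs_of_nonpos (by linarith)]
      have := Real.rpow_le_rpow (by linarith) (show -(t - t') ≤ t' by linarith) hγ.le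
      linarith
  set g : ℝ → ℂ := fun η => symbol a γ t η * conj (symbol a γ t' η) *
    Complex.exp (Complex.I * (((x - x') * η : ℝ) : ℂ)) with hg
  have hgc : Continuous g := by
    have h1 := continuous_symbol ha γ t
    have h2 := continuous_symbol ha γ t'
    fun_prop
  have hw : ∀ ξ, wave a γ t x ξ * conj (wave a γ t' x' ξ) = g (2 * Real.pi * ξ) := by
    intro ξ
    simp only [wave, hg, map_mul, ← Complex.exp_conj, Complex.conj_I, Complex.conj_ofReal]
    rw [mul_mul_mul_comm, ← Complex.exp_add]
    congr 2
    simp only [map_ofNat]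
    push_cast
    ring
  have hpos : ∀ η ∈ uIcc N (2 * N), |η| = η := fun η hη => by
    rw [uIcc_of_le (by linarith)] at hη
    exact abs_of_pos (by linarith [hη.1])
  have h1 : ∫ η in N..(2 * N), g η = dyadicOsc a (t ^ γ + t' ^ γ) (t - t') (x - x') N := by
    refine intervalIntegral.integral_congr fun η hη => ?_
    simp only [hg, symbol_mul_conj_symbol, hpos η hη]
    rw [mul_assoc, ← Complex.exp_add]
    congr 2
    push_cast
    ring
  have h2 : ∫ η in N..(2 * N), g (-η) =
      dyadicOsc a (t ^ γ + t' ^ γ) (t - t') (-(x - x')) N := by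
    refine intervalIntegral.integral_congr fun η hη => ?_
    simp only [hg, symbol_mul_conj_symbol, abs_neg, hpos η hη]
    rw [mul_assoc, ← Complex.exp_add]
    congr 2
    push_cast
    ring
  have h3 := norm_setIntegral_block_le hN hgc
  simp_rw [hw]
  rw [h1, h2] at h3
  have h4 := H (ε := ε) hγ hb hN (sub_ne_zero.2 hx) hε0 hε1
  have h5 := H (ε := ε) hγ hb hN (neg_ne_zero.2 (sub_ne_zero.2 hx)) hε0 hε1
  have h6 : majorant a γ q ε C N (-(x - x')) = majorant a γ q ε C N (x - x') := by
    rw [majorant, majorant, abs_neg]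
  rw [h6] at h5
  linarith

/-- A piece of the operator: the Fourier integral restricted to the frequency set `D`. -/
noncomputable def piece (a γ : ℝ) (D : Set ℝ) (g : ℝ → ℂ) (t x : ℝ) : ℂ :=
  ∫ ξ in D, g ξ * wave a γ t x ξ

lemma measurable_wave (a γ : ℝ) :
    Measurable fun z : ℝ × ℝ × ℝ => wave a γ z.1 z.2.1 z.2.2 := by
  unfold wave symbol
  fun_prop

/-- The maximal inequality for a linearised maximal operator on a dyadic block. -/
lemma exists_lintegral_piece_le {a : ℝ} (ha : 0 < a) (ha1 : a ≤ 1) {γ : ℝ} (hγ : 1 < γ) :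
    ∃ ε : ℝ, 0 < ε ∧ (a < 1 → ε = a / 2 * (1 - 1 / γ)) ∧ (a = 1 → ε = 1 - 1 / γ) ∧
      ∀ L : ℝ, ∃ C : ℝ, 0 ≤ C ∧ ∀ {N : ℝ}, 0 < N → ∀ {g : ℝ → ℂ}, Measurable g →
        MemLp g 2 volume → ∀ {τ : ℝ → ℝ}, Measurable τ → (∀ x, 0 ≤ τ x) →
        ∫⁻ x in Icc (-L) L, ‖piece a γ (block N) g (τ x) x‖ₑ ^ 2 ≤
          ENNReal.ofReal (C * N ^ ε) * ∫⁻ ξ in block N, ‖g ξ‖ₑ ^ 2 := by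
  obtain ⟨q, C, hq, hq', hC, H⟩ := exists_norm_kernel_block_le ha ha1
  have hγ' : 0 < 1 - 1 / γ := by
    rw [sub_pos, div_lt_one (by linarith)]; exact hγ
  have hγ'' : 1 - 1 / γ ≤ 1 := by
    have : 0 ≤ 1 / γ := by positivity
    linarith
  have hq1 : -1 < q ∧ q ≤ 0 := by
    rcases ha1.lt_or_eq with h | h
    · rw [hq h]; norm_num
    · rw [hq' h]; norm_num
  set ε := (1 + q) * (a * (1 - 1 / γ)) with hε
  have hε0 : 0 < ε := mul_pos (by linarith) (mul_pos ha hγ')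
  have hε1 : ε ≤ 1 := mul_le_one₀ (by linarith) (by positivity) (mul_le_one₀ ha1 hγ'.le hγ'')
  refine ⟨ε, hε0, fun h => by rw [hε, hq h]; ring, fun h => by rw [hε, hq' h, h]; ring,
    fun L => ?_⟩
  obtain ⟨C', hC', H'⟩ := exists_lintegral_majorant_le (a := a) (by linarith) hq1.1 hε hε0 hC
    (2 * L)
  refine ⟨2 * C', by positivity, fun {N} hN {g} hgm hg {τ} hτ hτ0 => ?_⟩
  have hfin : IsFiniteMeasure (volume.restrict (block N)) :=
    ⟨by rw [Measure.restrict_apply_univ]; exact volume_block_lt_top N⟩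
  -- Differences of points of `[-L, L]` lie in `[-2L, 2L]`, so the truncation loses nothing and
  -- turns both Schur integrals into translates of one finite integral.
  set κ : ℝ → ℝ≥0∞ := (Icc (-(2 * L)) (2 * L)).indicator
    (fun z => ENNReal.ofReal (majorant a γ q ε C N z)) with hκ
  have hκm : Measurable κ := by
    refine Measurable.indicator ?_ measurableSet_Icc
    unfold majorant
    fun_prop
  have hκi : ∫⁻ z, κ z ≤ ENNReal.ofReal (C' * N ^ ε) := by
    rw [hκ, lintegral_indicator measurableSet_Icc]
    exact H' hN
  have h2 : ENNReal.ofReal (2 * C' * N ^ ε) = 2 * ENNReal.ofReal (C' * N ^ ε) := by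
    rw [mul_assoc, ENNReal.ofReal_mul (by norm_num), ENNReal.ofReal_ofNat]
  rw [h2]
  refine lintegral_sq_le_of_kernel_le (μ := volume.restrict (Icc (-L) L))
    (ν := volume.restrict (block N)) (u := fun p : ℝ × ℝ => wave a γ (τ p.1) p.1 p.2)
    (h := g) (k := fun p => κ (p.1 - p.2)) (M := ENNReal.ofReal (C' * N ^ ε))
    ?_ (fun p => norm_wave_le a γ (hτ0 _) _ _) (hg.restrict _) hgm (by fun_prop) ?_ ?_ ?_
  · exact (measurable_wave a γ).comp (f := fun p : ℝ × ℝ => (τ p.1, p.1, p.2)) (by fun_prop)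
  · filter_upwards [ae_restrict_mem measurableSet_Icc] with x hx
    have h0 : ∀ᵐ x' : ℝ ∂volume.restrict (Icc (-L) L), x' ≠ x :=
      ae_restrict_of_ae (by simp [ae_iff, measure_singleton])
    filter_upwards [ae_restrict_mem measurableSet_Icc, h0] with x' hx' hne
    have hmem : x - x' ∈ Icc (-(2 * L)) (2 * L) :=
      ⟨by linarith [hx.1, hx'.2], by linarith [hx.2, hx'.1]⟩
    rw [hκ, indicator_of_mem hmem, ← ofReal_norm]
    exact ENNReal.ofReal_le_ofReal (H (by linarith) (hτ0 x) (hτ0 x') hN hne.symm hε0.le hε1)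
  · intro x
    refine (lintegral_mono' Measure.restrict_le_self le_rfl).trans (le_trans ?_ hκi)
    exact (lintegral_sub_left_eq_self κ x).le
  · intro x
    refine (lintegral_mono' Measure.restrict_le_self le_rfl).trans (le_trans ?_ hκi)
    exact (lintegral_sub_right_eq_self κ x).le

lemma measurable_wave_right (a γ t x : ℝ) : Measurable (wave a γ t x) :=
  (measurable_wave a γ).comp (f := fun ξ : ℝ => (t, x, ξ)) (by fun_prop)

/-- The absolute value extends the time to the whole line while keeping the wave bounded by 1. This
serves both the density argument in time and the limit at `0`. -/
lemma continuous_piece_abs {a γ : ℝ} (hγ : 0 < γ) {D : Set ℝ} {g : ℝ → ℂ}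
    (hg : IntegrableOn g D) (x : ℝ) :
    Continuous fun t : ℝ => piece a γ D g |t| x := by
  unfold piece
  refine continuous_of_dominated (bound := fun ξ => ‖g ξ‖)
    (fun t => hg.aestronglyMeasurable.mul (measurable_wave_right a γ _ x).aestronglyMeasurable)
    (fun t => ae_of_all _ fun ξ => ?_) hg.norm (ae_of_all _ fun ξ => ?_)
  · rw [norm_mul]
    exact mul_le_of_le_one_right (norm_nonneg _) (norm_wave_le a γ (abs_nonneg t) x ξ)
  · have : Continuous fun t : ℝ => |t| ^ γ := continuous_abs.rpow_const fun _ => Or.inr hγ.le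
    unfold wave symbol
    fun_prop

lemma measurable_piece (a γ : ℝ) {D : Set ℝ} {g : ℝ → ℂ} (hg : Measurable g) (t : ℝ) :
    Measurable (piece a γ D g t) := by
  refine StronglyMeasurable.measurable ?_
  refine StronglyMeasurable.integral_prod_right' (ν := volume.restrict D)
    (f := fun p : ℝ × ℝ => g p.2 * wave a γ t p.1 p.2) (Measurable.stronglyMeasurable ?_)
  exact (hg.comp measurable_snd).mul
    ((measurable_wave a γ).comp (f := fun p : ℝ × ℝ => (t, p.1, p.2)) (by fun_prop))

/-- A measurable choice of the time at which the maximum over finitely many times is attained. -/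
lemma exists_measurable_argmax {F : ℝ → ℝ → ℂ} (hF : ∀ t, Measurable (F t)) {T : ℕ → ℝ}
    (hT : ∀ j, 0 ≤ T j) (n : ℕ) : ∃ τ : ℝ → ℝ, Measurable τ ∧ (∀ x, 0 ≤ τ x) ∧
      Measurable (fun x => F (τ x) x) ∧ ∀ x, ∀ j ≤ n, ‖F (T j) x‖ₑ ≤ ‖F (τ x) x‖ₑ := by
  classical
  induction n with
  | zero =>
    refine ⟨fun _ => T 0, measurable_const, fun _ => hT 0, hF _, fun x j hj => ?_⟩
    rw [Nat.le_zero.1 hj]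
  | succ n ih =>
    obtain ⟨τ, hτ, hτ0, hFτ, h⟩ := ih
    set S : Set ℝ := {x | ‖F (τ x) x‖ₑ < ‖F (T (n + 1)) x‖ₑ} with hS
    have hSm : MeasurableSet S := measurableSet_lt hFτ.enorm (hF _).enorm
    refine ⟨fun x => if x ∈ S then T (n + 1) else τ x, Measurable.ite hSm measurable_const hτ,
      fun x => ?_, ?_, fun x j hj => ?_⟩
    · dsimp only
      split_ifs
      · exact hT _
      · exact hτ0 x
    · have : (fun x => F (if x ∈ S then T (n + 1) else τ x) x) =
          fun x => if x ∈ S then F (T (n + 1)) x else F (τ x) x := by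
        ext x; split_ifs <;> rfl
      rw [this]
      exact Measurable.ite hSm (hF _) hFτ
    · dsimp only
      rcases Nat.le_succ_iff.1 hj with hj | rfl
      · split_ifs with hx
        · exact (h x j hj).trans (le_of_lt hx)
        · exact h x j hj
      · split_ifs with hx
        · exact le_rfl
        · exact not_lt.1 hx

/-- The maximal inequality on a dyadic block. -/
lemma exists_maximal_le {a : ℝ} (ha : 0 < a) (ha1 : a ≤ 1) {γ : ℝ} (hγ : 1 < γ) :
    ∃ ε : ℝ, 0 < ε ∧ (a < 1 → ε = a / 2 * (1 - 1 / γ)) ∧ (a = 1 → ε = 1 - 1 / γ) ∧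
      ∀ L : ℝ, ∃ C : ℝ, 0 ≤ C ∧ ∀ {N : ℝ}, 0 < N → ∀ {g : ℝ → ℂ}, Measurable g →
        MemLp g 2 volume → ∃ m : ℝ → ℝ≥0∞, Measurable m ∧
        (∀ x t, 0 ≤ t → ‖piece a γ (block N) g t x‖ₑ ^ 2 ≤ m x) ∧
        ∫⁻ x in Icc (-L) L, m x ≤
          ENNReal.ofReal (C * N ^ ε) * ∫⁻ ξ in block N, ‖g ξ‖ₑ ^ 2 := by
  obtain ⟨ε, hε, h1, h2, H⟩ := exists_lintegral_piece_le ha ha1 hγ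
  refine ⟨ε, hε, h1, h2, fun L => ?_⟩
  obtain ⟨C, hC, H⟩ := H L
  refine ⟨C, hC, fun {N} hN {g} hgm hg => ?_⟩
  set F : ℝ → ℝ → ℂ := piece a γ (block N) g with hF
  have hFm : ∀ t, Measurable (F t) := measurable_piece a γ hgm
  set T : ℕ → ℝ := fun j => |TopologicalSpace.denseSeq ℝ j| with hT
  have hmeas : ∀ j, Measurable fun x => ‖F (T j) x‖ₑ ^ 2 := fun j => (hFm _).enorm.pow_const 2
  -- Continuity in time reduces the supremum to countably many times, which keeps it measurable.
  refine ⟨fun x => ⨆ j, ‖F (T j) x‖ₑ ^ 2, Measurable.iSup hmeas, fun x t ht => ?_, ?_⟩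
  · have hfin : IsFiniteMeasure (volume.restrict (block N)) :=
      ⟨by rw [Measure.restrict_apply_univ]; exact volume_block_lt_top N⟩
    have hgi : IntegrableOn g (block N) := (hg.restrict _).integrable (by norm_num)
    have hc : Continuous fun t : ℝ => ‖F |t| x‖ₑ ^ 2 :=
      (ENNReal.continuous_pow 2).comp (continuous_piece_abs (by linarith) hgi x).enorm
    have hcl : IsClosed {t : ℝ | ‖F |t| x‖ₑ ^ 2 ≤ ⨆ j, ‖F (T j) x‖ₑ ^ 2} :=
      isClosed_le hc continuous_const
    have hall := (TopologicalSpace.denseRange_denseSeq ℝ).induction_on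
      (p := fun t => ‖F |t| x‖ₑ ^ 2 ≤ ⨆ j, ‖F (T j) x‖ₑ ^ 2) t hcl
      fun j => le_iSup (fun j => ‖F (T j) x‖ₑ ^ 2) j
    rwa [abs_of_nonneg ht] at hall
  -- Monotone convergence reduces to finitely many times. There the maximum is attained at a
  -- measurable `τ`, and the linearised inequality holds with a constant independent of `τ`.
  · have hsup : ∀ x, ⨆ j, ‖F (T j) x‖ₑ ^ 2 =
        ⨆ n, partialSups (fun j => ‖F (T j) x‖ₑ ^ 2) n := fun x => (iSup_partialSups_eq _).symm
    simp_rw [hsup]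
    rw [lintegral_iSup]
    · refine iSup_le fun n => ?_
      obtain ⟨τ, hτ, hτ0, -, hmax⟩ := exists_measurable_argmax hFm (fun j => abs_nonneg _ :
        ∀ j, 0 ≤ T j) n
      refine (lintegral_mono fun x => ?_).trans (H hN hgm hg hτ hτ0)
      refine partialSups_le _ _ _ fun j hj => ?_
      gcongr
      exact hmax x j hj
    · intro n
      induction n with
      | zero => simpa using hmeas 0
      | succ n ih =>
        simp only [partialSups_add_one]
        exact ih.sup (hmeas _)
    · intro n n' hnn x
      exact (partialSups _).monotone hnn

end Maximal


/-! ### Sobolev regularity as a weighted `L²` bound. -/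

section Sobolev

open Set

/-- The weighted `L²` bound on the Fourier transform of a Sobolev function. -/
lemma lintegral_weight_fourier_lt_top {s : ℝ} {f : Lp ℂ 2 (volume : Measure ℝ)}
    (hf : TemperedDistribution.MemSobolev s 2 (f : 𝓢'(ℝ, ℂ))) :
    ∫⁻ ξ : ℝ, ENNReal.ofReal ((1 + ξ ^ 2) ^ s) *
      ‖(𝓕 f : Lp ℂ 2 (volume : Measure ℝ)) ξ‖ₑ ^ 2 < ∞ := by
  obtain ⟨f', hf'⟩ := TemperedDistribution.memSobolev_iff_exists_smulLeftCLM_fourier.1 hf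
  rw [Lp.fourier_toTemperedDistribution_eq] at hf'
  set g : Lp ℂ 2 (volume : Measure ℝ) := 𝓕 f with hg
  set c : ℝ → ℂ := fun x => (((1 + ‖x‖ ^ 2) ^ (s / 2) : ℝ) : ℂ) with hc
  have hct : c.HasTemperateGrowth := by fun_prop
  have hcc : Continuous c := by
    have : Continuous fun x : ℝ => (1 + ‖x‖ ^ 2) ^ (s / 2) :=
      Continuous.rpow_const (by fun_prop) fun x => Or.inl (by positivity)
    fun_prop
  have hgl : LocallyIntegrable (g : ℝ → ℂ) := (Lp.memLp g).locallyIntegrable (by norm_num)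
  have hloc : LocallyIntegrable fun x => c x * g x := by
    rw [locallyIntegrable_iff]
    exact fun K hK => (hgl.integrableOn_isCompact hK).continuousOn_mul hcc.continuousOn hK
  -- The equality of tempered distributions becomes an equality of functions by testing against
  -- smooth functions of compact support.
  have hae : (fun x => c x * g x) =ᵐ[volume] f' := by
    refine ae_eq_of_integral_contDiff_smul_eq hloc
      ((Lp.memLp f').locallyIntegrable (by norm_num)) fun φ hφ hφc => ?_
    have hφ1 : HasCompactSupport (Complex.ofRealCLM ∘ φ) := hφc.comp_left rfl
    have hφ2 : ContDiff ℝ ((⊤ : ℕ∞) : WithTop ℕ∞) (Complex.ofRealCLM ∘ φ) := by fun_prop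
    set ψ : 𝓢(ℝ, ℂ) := hφ1.toSchwartzMap hφ2 with hψ
    have h := congrArg (fun T : 𝓢'(ℝ, ℂ) => T ψ) hf'
    rw [TemperedDistribution.smulLeftCLM_apply_apply, Lp.toTemperedDistribution_apply,
      Lp.toTemperedDistribution_apply] at h
    calc _ = ∫ x, (SchwartzMap.smulLeftCLM ℂ c ψ) x • g x := by
          refine integral_congr_ae (ae_of_all _ fun x => ?_)
          simp only [SchwartzMap.smulLeftCLM_apply_apply hct]
          simp [hψ]
          ring
      _ = _ := h
      _ = _ := by simp [hψ]
  have hfin : ∫⁻ x, ‖f' x‖ₑ ^ 2 < ∞ := by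
    have := (lintegral_rpow_enorm_lt_top_of_eLpNorm_lt_top (p := 2) (by norm_num) (by norm_num)
      (Lp.memLp f').2)
    simpa using this
  refine lt_of_le_of_lt (le_of_eq (lintegral_congr_ae ?_)) hfin
  filter_upwards [hae] with x hx
  rw [← hx, enorm_mul, mul_pow]
  congr 1
  rw [← ofReal_norm, ← ENNReal.ofReal_pow (norm_nonneg _), Complex.norm_real,
    Real.norm_of_nonneg (by positivity), ← Real.rpow_mul_natCast (by positivity)]
  simp

end Sobolev

/-! ### Summation over dyadic blocks and convergence for Sobolev data. -/

section Convergence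

open Set

/-- The decomposition of the frequency line into low frequencies and dyadic blocks. -/
def dyadicSet : ℕ → Set ℝ
  | 0 => {ξ | |2 * Real.pi * ξ| < 1}
  | n + 1 => block (2 ^ n)

lemma measurableSet_dyadicSet : ∀ n, MeasurableSet (dyadicSet n)
  | 0 => measurableSet_lt (f := fun ξ : ℝ => |2 * Real.pi * ξ|) (by fun_prop) measurable_const
  | _ + 1 => measurableSet_block _

lemma volume_dyadicSet_lt_top : ∀ n, volume (dyadicSet n) < ∞
  | 0 => volume_abs_lt_lt_top 1
  | _ + 1 => volume_block_lt_top _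

lemma abs_lt_of_mem_dyadicSet {n : ℕ} {ξ : ℝ} (h : ξ ∈ dyadicSet n) :
    |2 * Real.pi * ξ| < 2 ^ n := by
  cases n with
  | zero => simpa [dyadicSet] using h
  | succ n => rw [pow_succ']; exact h.2

lemma pairwise_disjoint_dyadicSet : Pairwise (Function.onFun Disjoint dyadicSet) := by
  have key : ∀ m n, m < n → Disjoint (dyadicSet m) (dyadicSet n) := by
    intro m n hmn
    rw [Set.disjoint_left]
    intro ξ hm hn
    obtain ⟨k, rfl⟩ : ∃ k, n = k + 1 := ⟨n - 1, by omega⟩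
    have h1 := abs_lt_of_mem_dyadicSet hm
    have h2 : (2 : ℝ) ^ k ≤ |2 * Real.pi * ξ| := hn.1
    have h3 : (2 : ℝ) ^ m ≤ 2 ^ k := pow_le_pow_right₀ (by norm_num) (by omega)
    linarith
  intro m n hmn
  rcases lt_or_gt_of_ne hmn with h | h
  · exact key m n h
  · exact (key n m h).symm

lemma iUnion_dyadicSet : ⋃ n, dyadicSet n = univ := by
  refine eq_univ_of_forall fun ξ => ?_
  rw [mem_iUnion]
  rcases lt_or_ge |2 * Real.pi * ξ| 1 with h | h
  · exact ⟨0, h⟩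
  · obtain ⟨n, h1, h2⟩ := exists_nat_pow_near h (by norm_num : (1 : ℝ) < 2)
    exact ⟨n + 1, h1, by rw [← pow_succ']; exact h2⟩

lemma two_pow_rpow (n : ℕ) (r : ℝ) : ((2 : ℝ) ^ n) ^ r = (2 ^ r) ^ n := by
  rw [← Real.rpow_natCast, ← Real.rpow_natCast, ← Real.rpow_mul (by norm_num),
    ← Real.rpow_mul (by norm_num), mul_comm]

/-- On the block `|ξ| ≥ N/(2π)`, so the Sobolev weight is at least `(N/(2π))^{2s}`. -/
lemma lintegral_block_le {s : ℝ} (hs : 0 < s) {g : ℝ → ℂ} (hg : Measurable g) {N : ℝ}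
    (hN : 0 < N) :
    ∫⁻ ξ in block N, ‖g ξ‖ₑ ^ 2 ≤ ENNReal.ofReal ((2 * Real.pi) ^ (2 * s) * N ^ (-(2 * s))) *
      ∫⁻ ξ : ℝ, ENNReal.ofReal ((1 + ξ ^ 2) ^ s) * ‖g ξ‖ₑ ^ 2 := by
  rw [← lintegral_const_mul _ (by fun_prop), ← lintegral_indicator (measurableSet_block N)]
  refine lintegral_mono fun ξ => ?_
  by_cases hξ : ξ ∈ block N
  · rw [indicator_of_mem hξ, ← mul_assoc, ← ENNReal.ofReal_mul (by positivity)]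
    refine le_mul_of_one_le_left zero_le ?_
    rw [← ENNReal.ofReal_one]
    refine ENNReal.ofReal_le_ofReal ?_
    have h1 : N ≤ 2 * Real.pi * |ξ| := by
      have := hξ.1
      rwa [abs_mul, abs_of_pos Real.two_pi_pos] at this
    have h2 : (N / (2 * Real.pi)) ^ (2 * s) ≤ (1 + ξ ^ 2) ^ s := by
      rw [Real.rpow_mul (by positivity)]
      refine Real.rpow_le_rpow (by positivity) ?_ hs.le
      have h3 : N / (2 * Real.pi) ≤ |ξ| := by
        rw [div_le_iff₀ Real.two_pi_pos]; linarith
      rw [Real.rpow_two]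
      have h4 : (N / (2 * Real.pi)) ^ 2 ≤ |ξ| ^ 2 := by gcongr
      rw [sq_abs] at h4
      linarith
    calc (1 : ℝ) = (2 * Real.pi) ^ (2 * s) * N ^ (-(2 * s)) *
          (N / (2 * Real.pi)) ^ (2 * s) := by
          rw [Real.div_rpow hN.le (by positivity), Real.rpow_neg hN.le]
          have : (2 * Real.pi) ^ (2 * s) ≠ 0 := by positivity
          have : N ^ (2 * s) ≠ 0 := by positivity
          field_simp
      _ ≤ _ := by gcongr
  · rw [indicator_of_notMem hξ]; exact zero_le

/-- Almost everywhere, the pieces of the operator have a summable majorant. -/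
lemma ae_exists_summable_bound {a : ℝ} (ha : 0 < a) (ha1 : a ≤ 1) {γ s : ℝ} (hγ : 1 < γ)
    (hs1 : a < 1 → a / 4 * (1 - 1 / γ) < s) (hs2 : a = 1 → 1 / 2 * (1 - 1 / γ) < s)
    {g : ℝ → ℂ} (hgm : Measurable g) (hg : MemLp g 2 volume)
    (hS : ∫⁻ ξ : ℝ, ENNReal.ofReal ((1 + ξ ^ 2) ^ s) * ‖g ξ‖ₑ ^ 2 < ∞) :
    ∀ᵐ x : ℝ, ∃ b : ℕ → ℝ, Summable b ∧
      ∀ n t, 0 ≤ t → ‖piece a γ (dyadicSet n) g t x‖ ≤ b n := by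
  obtain ⟨ε, hε, hε1, hε2, H⟩ := exists_maximal_le ha ha1 hγ
  have hεs : ε < 2 * s := by
    rcases ha1.lt_or_eq with h | h
    · rw [hε1 h]; linarith [hs1 h]
    · rw [hε2 h]; linarith [hs2 h]
  have hs : 0 < s := by linarith
  set S := ∫⁻ ξ : ℝ, ENNReal.ofReal ((1 + ξ ^ 2) ^ s) * ‖g ξ‖ₑ ^ 2 with hSdef
  -- Half of the spare exponent is spent on the weight `2^{nδ}`; the other half leaves the
  -- convergent factor `2^{-nδ}`, as `δ + ε - 2s = -δ`.
  set δ := (2 * s - ε) / 2 with hδ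
  have hδ0 : 0 < δ := by rw [hδ]; linarith
  have hball : ∀ L : ℕ, ∀ᵐ x : ℝ, x ∈ Icc (-(L : ℝ)) L → ∃ b : ℕ → ℝ, Summable b ∧
      ∀ n t, 0 ≤ t → ‖piece a γ (dyadicSet n) g t x‖ ≤ b n := by
    intro L
    obtain ⟨C, hC, H⟩ := H L
    choose m hmm hm1 hm2 using fun n : ℕ => H (N := 2 ^ n) (by positivity) hgm hg
    set r : ℕ → ℝ≥0∞ := fun n => ENNReal.ofReal ((2 ^ n : ℝ) ^ δ) with hr
    have hsum : ∑' n, ∫⁻ x in Icc (-(L : ℝ)) L, r n * m n x ≠ ∞ := by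
      set K := C * (2 * Real.pi) ^ (2 * s) with hK
      have hb : ∀ n, ∫⁻ x in Icc (-(L : ℝ)) L, r n * m n x ≤
          ENNReal.ofReal (K * (2 ^ (-δ)) ^ n) * S := by
        intro n
        rw [lintegral_const_mul _ (hmm n)]
        calc _ ≤ r n * (ENNReal.ofReal (C * (2 ^ n) ^ ε) *
              (ENNReal.ofReal ((2 * Real.pi) ^ (2 * s) * (2 ^ n) ^ (-(2 * s))) * S)) := by
              gcongr
              exact (hm2 n).trans (by gcongr; exact lintegral_block_le hs hgm (by positivity))
          _ = _ := by
              rw [← mul_assoc, ← mul_assoc, hr, ← ENNReal.ofReal_mul (by positivity),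
                ← ENNReal.ofReal_mul (by positivity)]
              congr 2
              have h1 : (2 ^ (-δ) : ℝ) ^ n =
                  (2 ^ n : ℝ) ^ δ * (2 ^ n : ℝ) ^ ε * (2 ^ n : ℝ) ^ (-(2 * s)) := by
                rw [← two_pow_rpow, ← Real.rpow_add (by positivity),
                  ← Real.rpow_add (by positivity)]
                congr 1
                rw [hδ]; ring
              rw [h1, hK]; ring
      refine ne_top_of_le_ne_top ?_ (ENNReal.tsum_le_tsum hb)
      rw [ENNReal.tsum_mul_right, ← ENNReal.ofReal_tsum_of_nonneg (fun n => by positivity)]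
      · exact ENNReal.mul_ne_top ENNReal.ofReal_ne_top hS.ne
      · refine (summable_geometric_of_lt_one (by positivity) ?_).mul_left K
        exact Real.rpow_lt_one_of_one_lt_of_neg (by norm_num) (by linarith)
    rw [← lintegral_tsum fun n => ((hmm n).const_mul _).aemeasurable] at hsum
    have hae := ae_lt_top' (AEMeasurable.tsum fun n => ((hmm n).const_mul
      (r n)).aemeasurable) hsum
    rw [ae_restrict_iff' measurableSet_Icc] at hae
    filter_upwards [hae] with x hx hxL
    have hx1 := (hx hxL).ne
    have hxn : ∀ n, r n * m n x ≠ ∞ := ENNReal.ne_top_of_tsum_ne_top hx1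
    have hsm : Summable fun n => (r n * m n x).toReal := ENNReal.summable_toReal hx1
    have hgi : IntegrableOn g (dyadicSet 0) := by
      have hfin : IsFiniteMeasure (volume.restrict (dyadicSet 0)) :=
        ⟨by rw [Measure.restrict_apply_univ]; exact volume_dyadicSet_lt_top 0⟩
      exact (hg.restrict _).integrable (by norm_num)
    -- The low frequencies need no maximal inequality, only the local integrability of `g`.
    refine ⟨fun n => Nat.casesOn n (∫ ξ in dyadicSet 0, ‖g ξ‖)
      (fun n => (2 ^ (-δ)) ^ n + (r n * m n x).toReal), ?_, ?_⟩
    · rw [← summable_nat_add_iff 1]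
      exact (summable_geometric_of_lt_one (by positivity)
        (Real.rpow_lt_one_of_one_lt_of_neg (by norm_num) (by linarith))).add hsm
    · intro n t ht
      cases n with
      | zero =>
        refine norm_integral_le_of_norm_le hgi.norm (ae_of_all _ fun ξ => ?_)
        rw [norm_mul]
        exact mul_le_of_le_one_right (norm_nonneg _) (norm_wave_le a γ ht x ξ)
      | succ n =>
        set z := ‖piece a γ (dyadicSet (n + 1)) g t x‖ with hz
        have hz0 : 0 ≤ z := norm_nonneg _
        set ρ : ℝ := (2 ^ n : ℝ) ^ δ with hρ
        have hρ0 : 0 < ρ := by positivity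
        have h1 : ρ * z ^ 2 ≤ (r n * m n x).toReal := by
          rw [← ENNReal.ofReal_le_iff_le_toReal (hxn n), ENNReal.ofReal_mul hρ0.le,
            ENNReal.ofReal_pow hz0, hz, ofReal_norm]
          gcongr
          exact hm1 n x t ht
        have h2 : (2 ^ (-δ) : ℝ) ^ n = ρ⁻¹ := by
          rw [← two_pow_rpow, Real.rpow_neg (by positivity)]
        -- This passes from weighted summability of the squares to summability of the pieces
        -- themselves.
        have h3 : z ≤ ρ⁻¹ + ρ * z ^ 2 := by
          have h4 : ρ * ρ⁻¹ = 1 := mul_inv_cancel₀ hρ0.ne'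
          have h5 : 0 < ρ⁻¹ := inv_pos.2 hρ0
          nlinarith [mul_nonneg h5.le (sq_nonneg (ρ * z - 1 / 2)), mul_nonneg hρ0.le (sq_nonneg z)]
        change z ≤ (2 ^ (-δ)) ^ n + (r n * m n x).toReal
        rw [h2]
        linarith
  filter_upwards [ae_all_iff.2 hball] with x hx
  obtain ⟨L, hL⟩ := exists_nat_ge |x|
  exact hx L (abs_le.1 hL)

lemma integrableOn_dyadicSet {g : ℝ → ℂ} (hg : MemLp g 2 volume) (n : ℕ) :
    IntegrableOn g (dyadicSet n) := by
  have hfin : IsFiniteMeasure (volume.restrict (dyadicSet n)) :=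
    ⟨by rw [Measure.restrict_apply_univ]; exact volume_dyadicSet_lt_top n⟩
  exact (hg.restrict _).integrable (by norm_num)

lemma tendsto_piece {a γ : ℝ} (hγ : 0 < γ) {D : Set ℝ} {g : ℝ → ℂ} (hg : IntegrableOn g D)
    (x : ℝ) : Tendsto (fun t => piece a γ D g t x) (𝓝[>] 0) (𝓝 (piece a γ D g 0 x)) := by
  have h := (continuous_piece_abs (a := a) hγ hg x).tendsto 0
  rw [abs_zero] at h
  refine (h.mono_left nhdsWithin_le_nhds).congr' ?_
  filter_upwards [self_mem_nhdsWithin] with t ht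
  rw [abs_of_pos (show (0 : ℝ) < t from ht)]

/-- The indicators of an exhaustion converge in `L²`. -/
lemma tendsto_toLp_indicator {g : Lp ℂ 2 (volume : Measure ℝ)} {U : ℕ → Set ℝ}
    (hU : ∀ n, MeasurableSet (U n)) (hUm : ∀ ξ, ∀ᶠ n in atTop, ξ ∈ U n) :
    Tendsto (fun n => ((Lp.memLp g).indicator (hU n)).toLp ((U n).indicator g)) atTop (𝓝 g) := by
  rw [Lp.tendsto_Lp_iff_tendsto_eLpNorm']
  have hfin : ∫⁻ ξ, ‖g ξ‖ₑ ^ (2 : ℝ) < ∞ := by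
    have := (lintegral_rpow_enorm_lt_top_of_eLpNorm_lt_top (p := 2) (by norm_num) (by norm_num)
      (Lp.memLp g).2)
    simpa using this
  have h1 : ∀ n, eLpNorm ((((Lp.memLp g).indicator (hU n)).toLp ((U n).indicator g) : ℝ → ℂ) - (g : ℝ → ℂ))
      2 volume = (∫⁻ ξ, ‖(U n)ᶜ.indicator g ξ‖ₑ ^ (2 : ℝ)) ^ (1 / 2 : ℝ) := by
    intro n
    rw [eLpNorm_congr_ae (g := (U n).indicator g - (g : ℝ → ℂ))
      (((Lp.memLp g).indicator (hU n)).coeFn_toLp.sub EventuallyEq.rfl),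
      eLpNorm_eq_lintegral_rpow_enorm_toReal (by norm_num) (by norm_num)]
    simp only [ENNReal.toReal_ofNat]
    congr 1
    refine lintegral_congr fun ξ => ?_
    by_cases h : ξ ∈ U n <;> simp [h]
  simp_rw [h1]
  have h2 : Tendsto (fun n => ∫⁻ ξ, ‖(U n)ᶜ.indicator g ξ‖ₑ ^ (2 : ℝ)) atTop
      (𝓝 (∫⁻ _ : ℝ, 0)) := by
    refine tendsto_lintegral_of_dominated_convergence (fun ξ => ‖g ξ‖ₑ ^ (2 : ℝ))
      (fun n => ?_) (fun n => ae_of_all _ fun ξ => ?_) hfin.ne (ae_of_all _ fun ξ => ?_)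
    · exact (((Lp.stronglyMeasurable g).measurable.indicator (hU n).compl).enorm).pow_const _
    · by_cases h : ξ ∈ U n <;> simp [h]
    · refine tendsto_const_nhds.congr' ?_
      filter_upwards [hUm ξ] with n hn
      simp [hn]
  simpa using! (ENNReal.continuous_rpow_const (y := 1 / 2)).tendsto _ |>.comp h2

/-- Fourier inversion in terms of the dyadic decomposition. -/
lemma tsum_piece_zero_eq {a γ : ℝ} (hγ : 0 < γ) (f : Lp ℂ 2 (volume : Measure ℝ)) :
    ∀ᵐ x : ℝ, (Summable fun n => piece a γ (dyadicSet n)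
      (𝓕 f : Lp ℂ 2 (volume : Measure ℝ)) 0 x) →
      ∑' n, piece a γ (dyadicSet n) (𝓕 f : Lp ℂ 2 (volume : Measure ℝ)) 0 x = f x := by
  set g : Lp ℂ 2 (volume : Measure ℝ) := 𝓕 f with hg
  set U : ℕ → Set ℝ := fun k => ⋃ n ∈ Finset.range k, dyadicSet n with hU
  have hUm : ∀ k, MeasurableSet (U k) := fun k =>
    Finset.measurableSet_biUnion _ fun n _ => measurableSet_dyadicSet n
  have hUe : ∀ ξ, ∀ᶠ k in atTop, ξ ∈ U k := by
    intro ξ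
    have : ξ ∈ ⋃ n, dyadicSet n := by rw [iUnion_dyadicSet]; trivial
    obtain ⟨n, hn⟩ := mem_iUnion.1 this
    filter_upwards [eventually_gt_atTop n] with k hk
    exact mem_biUnion (by simpa using hk) hn
  have hint : ∀ k, Integrable ((U k).indicator g) := fun k => by
    rw [integrable_indicator_iff (hUm k)]
    exact integrableOn_finset_iUnion.2 fun n _ => integrableOn_dyadicSet (Lp.memLp g) n
  have hpart : ∀ k x, ∑ n ∈ Finset.range k, piece a γ (dyadicSet n) g 0 x =
      𝓕⁻ ((U k).indicator g) x := by
    intro k x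
    have hwave : ∀ ξ, wave a γ 0 x ξ = Complex.exp (2 * Real.pi * Complex.I * x * ξ) := by
      intro ξ
      simp [wave, symbol, Real.zero_rpow hγ.ne']
    unfold piece
    rw [Real.fourierInv_eq', ← integral_biUnion_finset _ (fun n _ => measurableSet_dyadicSet n)
      (fun m _ n _ hmn => pairwise_disjoint_dyadicSet hmn)
      (fun n _ => (integrableOn_dyadicSet (Lp.memLp g) n).mul_bdd (c := 1)
        (measurable_wave_right a γ 0 x).aestronglyMeasurable
        (ae_of_all _ (norm_wave_le a γ le_rfl x))), ← integral_indicator (hUm k)]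
    refine integral_congr_ae (ae_of_all _ fun ξ => ?_)
    by_cases h : ξ ∈ U k
    · simp only [indicator_of_mem h, hwave, smul_eq_mul]
      rw [mul_comm]
      congr 2
      simp
      ring
    · simp [indicator_of_notMem h]
  have hlim : Tendsto (fun k => (𝓕⁻ (((Lp.memLp g).indicator (hUm k)).toLp ((U k).indicator g)) :
      Lp ℂ 2 (volume : Measure ℝ))) atTop (𝓝 f) := by
    have h1 := tendsto_toLp_indicator (g := g) hUm hUe
    have h2 := ((Lp.fourierTransformₗᵢ ℝ ℂ).symm.continuous.tendsto g).comp h1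
    have h3 : (Lp.fourierTransformₗᵢ ℝ ℂ).symm g = f :=
      (Lp.fourierTransformₗᵢ ℝ ℂ).symm_apply_apply f
    rw [h3] at h2
    exact h2
  -- Convergence in `L²` identifies the limit only along a subsequence of partial sums. That is
  -- enough, because the series is assumed summable at the point.
  obtain ⟨ns, hns, hae⟩ := (tendstoInMeasure_of_tendsto_Lp hlim).exists_seq_tendsto_ae
  have hae2 := ae_all_iff.2 fun k => fourierInv_toLp_ae (hint k) ((Lp.memLp g).indicator (hUm k))
  filter_upwards [hae, hae2] with x hx hx2 hsum
  have h1 := hsum.hasSum.tendsto_sum_nat.comp hns.tendsto_atTop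
  refine tendsto_nhds_unique h1 (hx.congr fun k => ?_)
  rw [Function.comp_apply, hpart, hx2]

lemma integrable_opL2 {a γ t : ℝ} (ha : 0 < a) (ht : 0 < t) (f : Lp ℂ 2 (volume : Measure ℝ))
    (x : ℝ) : Integrable fun ξ : ℝ => (𝓕 f : Lp ℂ 2 (volume : Measure ℝ)) ξ *
      symbol a γ t (2 * Real.pi * ξ) * Complex.exp (2 * Real.pi * Complex.I * x * ξ) := by
  have h : Integrable fun ξ : ℝ => (𝓕 f : Lp ℂ 2 (volume : Measure ℝ)) ξ *
      (symbol a γ t (2 * Real.pi * ξ) * Complex.exp (2 * Real.pi * Complex.I * x * ξ)) :=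
    MemLp.integrable_mul (Lp.memLp (𝓕 f : Lp ℂ 2 (volume : Measure ℝ)))
      (symbol_wave ha ht x 2 (Or.inr rfl))
  exact h.congr (ae_of_all _ fun ξ => (mul_assoc _ _ _).symm)

/-- Pointwise convergence for Sobolev functions. -/
lemma ae_tendsto_opL2 {a : ℝ} (ha : 0 < a) (ha1 : a ≤ 1) {γ s : ℝ} (hγ : 1 < γ)
    (hs1 : a < 1 → a / 4 * (1 - 1 / γ) < s) (hs2 : a = 1 → 1 / 2 * (1 - 1 / γ) < s)
    (f : Lp ℂ 2 (volume : Measure ℝ))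
    (hf : TemperedDistribution.MemSobolev s 2 (f : 𝓢'(ℝ, ℂ))) :
    ∀ᵐ x : ℝ, Tendsto (fun t : ℝ => opL2 a γ t f x) (𝓝[>] 0) (𝓝 (f x)) := by
  have hγ0 : 0 < γ := by linarith
  set g : Lp ℂ 2 (volume : Measure ℝ) := 𝓕 f with hg
  filter_upwards [ae_exists_summable_bound ha ha1 hγ hs1 hs2 (Lp.stronglyMeasurable g).measurable
    (Lp.memLp g) (lintegral_weight_fourier_lt_top hf), tsum_piece_zero_eq (a := a) hγ0 f]
    with x ⟨b, hb, hbd⟩ hx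
  rw [← hx (hb.of_norm_bounded fun n => hbd n 0 le_rfl)]
  -- The majorant is uniform in `t`, so the limit passes through the sum although each block
  -- converges at its own rate.
  have h := tendsto_tsum_of_dominated_convergence hb
    (fun n => tendsto_piece (a := a) hγ0 (integrableOn_dyadicSet (Lp.memLp g) n) x)
    (by filter_upwards [self_mem_nhdsWithin] with t ht n using hbd n t (le_of_lt ht))
  refine h.congr' ?_
  filter_upwards [self_mem_nhdsWithin] with t ht
  have h2 := hasSum_integral_iUnion measurableSet_dyadicSet pairwise_disjoint_dyadicSet
    (integrable_opL2 (γ := γ) ha ht f x).integrableOn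
  rw [iUnion_dyadicSet, setIntegral_univ] at h2
  rw [opL2, ← h2.tsum_eq]
  refine tsum_congr fun n => ?_
  unfold piece wave
  simp only [mul_assoc, hg]

end Convergence


/-! ### Size and decay of the convolution kernel. -/

section KernelDecay

open Set

/-- The symbol `e^{-zη^a}` of complex time `z` on the half line. -/
noncomputable def expSymbol (a : ℝ) (z : ℂ) (η : ℝ) : ℂ := Complex.exp (-z * ((η ^ a : ℝ) : ℂ))

/-- The derivative of `expSymbol`. -/
noncomputable def expSymbolDeriv (a : ℝ) (z : ℂ) (η : ℝ) : ℂ :=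
  expSymbol a z η * (-z * ((a * η ^ (a - 1) : ℝ) : ℂ))

/-- The second derivative of `expSymbol`. -/
noncomputable def expSymbolDeriv2 (a : ℝ) (z : ℂ) (η : ℝ) : ℂ :=
  expSymbolDeriv a z η * (-z * ((a * η ^ (a - 1) : ℝ) : ℂ)) +
    expSymbol a z η * (-z * ((a * ((a - 1) * η ^ (a - 1 - 1)) : ℝ) : ℂ))

variable {a : ℝ} {z : ℂ} {η : ℝ}

lemma norm_expSymbol (a : ℝ) (z : ℂ) (η : ℝ) :
    ‖expSymbol a z η‖ = Real.exp (-z.re * η ^ a) := by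
  rw [expSymbol, Complex.norm_exp, Complex.re_mul_ofReal, Complex.neg_re]

lemma norm_expSymbol_le_one (hz : 0 ≤ z.re) (hη : 0 ≤ η) : ‖expSymbol a z η‖ ≤ 1 := by
  rw [norm_expSymbol, Real.exp_le_one_iff, neg_mul, neg_nonpos]
  positivity

lemma hasDerivAt_expSymbol (hη : 0 < η) :
    HasDerivAt (expSymbol a z) (expSymbolDeriv a z η) η :=
  (((Real.hasDerivAt_rpow_const (Or.inl hη.ne')).ofReal_comp).const_mul (-z)).cexp

lemma hasDerivAt_expSymbolDeriv (hη : 0 < η) :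
    HasDerivAt (expSymbolDeriv a z) (expSymbolDeriv2 a z η) η :=
  (hasDerivAt_expSymbol hη).mul
    (((((Real.hasDerivAt_rpow_const (p := a - 1) (Or.inl hη.ne')).const_mul
      a).ofReal_comp).const_mul (-z)))

lemma norm_expSymbolDeriv (ha : 0 < a) (hη : 0 < η) :
    ‖expSymbolDeriv a z η‖ = ‖z‖ * a * (η ^ (a - 1) * Real.exp (-z.re * η ^ a)) := by
  have : 0 ≤ a * η ^ (a - 1) := by positivity
  rw [expSymbolDeriv, norm_mul, norm_expSymbol, norm_mul, norm_neg, Complex.norm_real,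
    Real.norm_of_nonneg this]
  ring

lemma norm_expSymbolDeriv_le (ha : 0 < a) (hz : 0 ≤ z.re) (hη : 0 < η) :
    ‖expSymbolDeriv a z η‖ ≤ ‖z‖ * a * η ^ (a - 1) := by
  rw [norm_expSymbolDeriv ha hη]
  have h1 : Real.exp (-z.re * η ^ a) ≤ 1 := by
    rw [← norm_expSymbol]; exact norm_expSymbol_le_one hz hη.le
  have h2 : 0 ≤ η ^ (a - 1) := by positivity
  gcongr
  exact mul_le_of_le_one_right h2 h1

/-- Bounding only one of the two factors `η^{a-1}` by `M` leaves a majorant with an elementary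
antiderivative. -/
lemma norm_expSymbolDeriv2_le (ha : 0 < a) (ha1 : a ≤ 1) (hz : 0 ≤ z.re) (hη : 0 < η) {M : ℝ}
    (hM : η ^ (a - 1) ≤ M) :
    ‖expSymbolDeriv2 a z η‖ ≤ ‖z‖ ^ 2 * a ^ 2 * M * (η ^ (a - 1) * Real.exp (-z.re * η ^ a)) +
      ‖z‖ * a * ((1 - a) * η ^ (a - 1 - 1)) := by
  have h0 : 0 ≤ η ^ (a - 1) := by positivity
  have h0' : 0 ≤ η ^ (a - 1 - 1) := by positivity
  refine (norm_add_le _ _).trans (add_le_add ?_ ?_)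
  · rw [norm_mul, norm_expSymbolDeriv ha hη, norm_mul, norm_neg, Complex.norm_real,
      Real.norm_of_nonneg (by positivity)]
    calc _ = ‖z‖ ^ 2 * a ^ 2 * η ^ (a - 1) * (η ^ (a - 1) * Real.exp (-z.re * η ^ a)) := by ring
      _ ≤ _ := by gcongr
  · rw [norm_mul, norm_mul, norm_neg, Complex.norm_real, Real.norm_eq_abs, abs_mul, abs_mul,
      abs_of_pos ha, abs_of_nonneg h0', abs_of_nonpos (by linarith)]
    have h1 := norm_expSymbol_le_one (a := a) hz hη.le
    have h2 : 0 ≤ -(a - 1) := by linarith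
    calc _ ≤ 1 * (‖z‖ * (a * (-(a - 1) * η ^ (a - 1 - 1)))) := by gcongr
      _ = _ := by ring

lemma integrableOn_rpow_mul_exp (ha : 0 < a) {b q : ℝ} (hb : 0 < b) (hq : -1 < q) :
    IntegrableOn (fun η : ℝ => η ^ q * Real.exp (-b * η ^ a)) (Ioi 0) :=
  integrableOn_rpow_mul_exp_neg_mul_rpow hq ha hb

lemma continuousOn_expSymbol (a : ℝ) (z : ℂ) : ContinuousOn (expSymbol a z) (Ioi 0) :=
  fun _ hη => (hasDerivAt_expSymbol hη).continuousAt.continuousWithinAt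

lemma continuousOn_expSymbolDeriv (a : ℝ) (z : ℂ) : ContinuousOn (expSymbolDeriv a z) (Ioi 0) :=
  fun _ hη => (hasDerivAt_expSymbolDeriv hη).continuousAt.continuousWithinAt

lemma continuousOn_expSymbolDeriv2 (a : ℝ) (z : ℂ) :
    ContinuousOn (expSymbolDeriv2 a z) (Ioi 0) := by
  have h : ∀ q : ℝ, ContinuousOn (fun η : ℝ => η ^ q) (Ioi 0) := fun q =>
    continuousOn_id.rpow_const fun _ hη => Or.inl (ne_of_gt hη)
  have h0 := h (a - 1)
  have h1 := h (a - 1 - 1)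
  have h2 := continuousOn_expSymbol a z
  have h3 := continuousOn_expSymbolDeriv a z
  unfold expSymbolDeriv2
  fun_prop

lemma integrableOn_expSymbol (ha : 0 < a) (hz : 0 < z.re) :
    IntegrableOn (expSymbol a z) (Ioi 0) := by
  refine Integrable.mono' (integrableOn_rpow_mul_exp ha hz (q := 0) (by norm_num))
    ((continuousOn_expSymbol a z).aestronglyMeasurable measurableSet_Ioi) (ae_of_all _ fun η => ?_)
  rw [norm_expSymbol]; simp

lemma integrableOn_expSymbolDeriv (ha : 0 < a) (hz : 0 < z.re) :
    IntegrableOn (expSymbolDeriv a z) (Ioi 0) := by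
  refine Integrable.mono' ((integrableOn_rpow_mul_exp ha hz (q := a - 1) (by linarith)).const_mul
    (‖z‖ * a)) ((continuousOn_expSymbolDeriv a z).aestronglyMeasurable measurableSet_Ioi) ?_
  filter_upwards [ae_restrict_mem measurableSet_Ioi] with η hη
  exact (norm_expSymbolDeriv ha hη).le

/-- The cosine transform of the symbol. -/
noncomputable def cosTransform (a : ℝ) (z : ℂ) (x : ℝ) : ℂ :=
  ∫ η in Ioi (0 : ℝ), expSymbol a z η * ((Real.cos (x * η) : ℝ) : ℂ)

lemma norm_cosTransform_le (ha : 0 < a) (hz : 0 < z.re) (x : ℝ) :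
    ‖cosTransform a z x‖ ≤ 1 / a * Real.Gamma (1 / a) * z.re ^ (-(1 / a)) := by
  refine (norm_integral_le_of_norm_le (integrableOn_rpow_mul_exp ha hz (q := 0) (by norm_num))
    (ae_of_all _ fun η => ?_)).trans_eq ?_
  · rw [norm_mul, norm_expSymbol, Complex.norm_real, Real.rpow_zero, one_mul]
    exact mul_le_of_le_one_right (Real.exp_pos _).le (Real.abs_cos_le_one _)
  · rw [integral_rpow_mul_exp_neg_mul_rpow ha (by norm_num) hz]
    rw [zero_add, neg_div]
    ring

lemma hasDerivAt_sin_div {x : ℝ} (hx : x ≠ 0) (η : ℝ) :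
    HasDerivAt (fun η : ℝ => ((Real.sin (x * η) / x : ℝ) : ℂ)) ((Real.cos (x * η) : ℝ) : ℂ) η := by
  refine HasDerivAt.ofReal_comp ?_
  have := (((hasDerivAt_id η).const_mul x).sin).div_const x
  convert! this using 1
  simp; field_simp

lemma hasDerivAt_neg_cos_div {x : ℝ} (hx : x ≠ 0) (η : ℝ) :
    HasDerivAt (fun η : ℝ => ((-(Real.cos (x * η) / x) : ℝ) : ℂ))
      ((Real.sin (x * η) : ℝ) : ℂ) η := by
  refine HasDerivAt.ofReal_comp ?_
  have := ((((hasDerivAt_id η).const_mul x).cos).div_const x).neg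
  convert! this using 1
  simp; field_simp

/-- Integration by parts. The boundary term vanishes at `0` thanks to the sine and at infinity
thanks to the damping; the singularity `η^{a-1}` of the derivative is integrable. -/
lemma cosTransform_eq (ha : 0 < a) (hz : 0 < z.re) {x : ℝ} (hx : 0 < x) :
    cosTransform a z x =
      -∫ η in Ioi (0 : ℝ), expSymbolDeriv a z η * ((Real.sin (x * η) / x : ℝ) : ℂ) := by
  have hb : ∀ η : ℝ, ‖((Real.sin (x * η) / x : ℝ) : ℂ)‖ ≤ 1 / x := fun η => by
    rw [Complex.norm_real, norm_div, Real.norm_of_nonneg hx.le]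
    gcongr
    exact Real.abs_sin_le_one _
  have h := integral_Ioi_mul_deriv_eq_deriv_mul (a := 0) (a' := 0) (b' := 0) (u := expSymbol a z)
    (u' := expSymbolDeriv a z) (v := fun η : ℝ => ((Real.sin (x * η) / x : ℝ) : ℂ))
    (v' := fun η : ℝ => ((Real.cos (x * η) : ℝ) : ℂ))
    (fun η hη => hasDerivAt_expSymbol hη) (fun η _ => hasDerivAt_sin_div hx.ne' η) ?_ ?_ ?_ ?_
  · rw [cosTransform, h]; simp
  · refine (integrableOn_expSymbol ha hz).mul_bdd (c := 1)
      (Continuous.aestronglyMeasurable (by fun_prop)) (ae_of_all _ fun η => ?_)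
    rw [Complex.norm_real]; exact Real.abs_cos_le_one _
  · exact (integrableOn_expSymbolDeriv ha hz).mul_bdd (c := 1 / x)
      (Continuous.aestronglyMeasurable (by fun_prop)) (ae_of_all _ hb)
  · have h0 : Tendsto (fun η : ℝ => ‖((Real.sin (x * η) / x : ℝ) : ℂ)‖) (𝓝[>] 0) (𝓝 0) := by
      have : Continuous fun η : ℝ => ‖((Real.sin (x * η) / x : ℝ) : ℂ)‖ := by fun_prop
      have := (this.tendsto 0).mono_left (nhdsWithin_le_nhds (s := Ioi 0))
      simpa using! this
    refine squeeze_zero_norm' ?_ h0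
    filter_upwards [self_mem_nhdsWithin] with η hη
    rw [Pi.mul_apply, norm_mul]
    exact mul_le_of_le_one_left (norm_nonneg _) (norm_expSymbol_le_one hz.le (le_of_lt hη))
  · have h0 : Tendsto (fun η : ℝ => Real.exp (-z.re * η ^ a) * (1 / x)) atTop (𝓝 (0 * (1 / x))) := by
      refine Tendsto.mul_const _ (Real.tendsto_exp_atBot.comp ?_)
      exact (tendsto_rpow_atTop ha).const_mul_atTop_of_neg (by linarith)
    rw [zero_mul] at h0
    refine squeeze_zero_norm (fun η => ?_) h0
    rw [Pi.mul_apply, norm_mul, norm_expSymbol]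
    gcongr
    exact hb η

lemma inv_rpow_sub_one {x : ℝ} (hx : 0 < x) (a : ℝ) : (1 / x) ^ (a - 1) = x ^ (1 - a) := by
  rw [one_div, Real.inv_rpow hx.le, ← Real.rpow_neg hx.le, neg_sub]

/-- The tail of the sine transform of the derivative of the symbol, on a bounded interval. -/
lemma norm_sineTransform_tail_le (ha : 0 < a) (ha1 : a ≤ 1) {κ : ℝ} (hz : 0 < z.re)
    (hκ : 1 ≤ κ) (hzκ : ‖z‖ ≤ κ * z.re) {x R : ℝ} (hx : 0 < x) (hR : 1 / x ≤ R) :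
    ‖∫ η in (1 / x)..R, expSymbolDeriv a z η * ((Real.sin (x * η) : ℝ) : ℂ)‖ ≤
      4 * κ ^ 2 * z.re * x ^ (-a) := by
  have hx' : 0 < 1 / x := by positivity
  have hpos : ∀ η ∈ Icc (1 / x) R, 0 < η := fun η hη => hx'.trans_le hη.1
  have hsub : Icc (1 / x) R ⊆ Ioi 0 := hpos
  have hu : uIcc (1 / x) R = Icc (1 / x) R := uIcc_of_le hR
  set M := x ^ (1 - a) with hM
  have hM0 : 0 < M := by positivity
  have hMb : ∀ η ∈ Icc (1 / x) R, η ^ (a - 1) ≤ M := fun η hη => by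
    rw [hM, ← inv_rpow_sub_one hx]
    exact Real.rpow_le_rpow_of_nonpos hx' hη.1 (by linarith)
  have hc2 : ContinuousOn (expSymbolDeriv2 a z) (uIcc (1 / x) R) := by
    rw [hu]; exact (continuousOn_expSymbolDeriv2 a z).mono hsub
  have hibp := intervalIntegral.integral_mul_deriv_eq_deriv_mul (a := 1 / x) (b := R)
    (u := expSymbolDeriv a z) (u' := expSymbolDeriv2 a z)
    (v := fun η : ℝ => ((-(Real.cos (x * η) / x) : ℝ) : ℂ))
    (v' := fun η : ℝ => ((Real.sin (x * η) : ℝ) : ℂ))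
    (fun η hη => hasDerivAt_expSymbolDeriv (hpos η (hu ▸ hη)))
    (fun η _ => hasDerivAt_neg_cos_div hx.ne' η) hc2.intervalIntegrable
    (Continuous.intervalIntegrable (by fun_prop) _ _)
  have hv : ∀ η : ℝ, ‖((-(Real.cos (x * η) / x) : ℝ) : ℂ)‖ ≤ 1 / x := fun η => by
    rw [Complex.norm_real, norm_neg, norm_div, Real.norm_of_nonneg hx.le]
    gcongr
    exact Real.abs_cos_le_one _
  have hbd : ∀ η ∈ Icc (1 / x) R, ‖expSymbolDeriv a z η *
      ((-(Real.cos (x * η) / x) : ℝ) : ℂ)‖ ≤ ‖z‖ * a * M * (1 / x) := fun η hη => by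
    rw [norm_mul]
    have h1 := norm_expSymbolDeriv_le (a := a) ha hz.le (hpos η hη)
    have h2 : ‖z‖ * a * η ^ (a - 1) ≤ ‖z‖ * a * M := by gcongr; exact hMb η hη
    exact mul_le_mul (h1.trans h2) (hv η) (norm_nonneg _) (by positivity)
  -- The antiderivative of the majorant of the second derivative. It is nonpositive, so its value at
  -- `R` can be dropped and the bound is uniform in `R`.
  set G : ℝ → ℝ := fun η => -(‖z‖ ^ 2 * a * M / z.re * Real.exp (-z.re * η ^ a)) -
    ‖z‖ * a * η ^ (a - 1) with hG
  set G' : ℝ → ℝ := fun η => ‖z‖ ^ 2 * a ^ 2 * M * (η ^ (a - 1) * Real.exp (-z.re * η ^ a)) +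
    ‖z‖ * a * ((1 - a) * η ^ (a - 1 - 1)) with hG'
  have hGd : ∀ η ∈ uIcc (1 / x) R, HasDerivAt G (G' η) η := fun η hη => by
    have hη0 := hpos η (hu ▸ hη)
    have h1 := ((((Real.hasDerivAt_rpow_const (p := a) (Or.inl hη0.ne')).const_mul
      (-z.re)).exp).const_mul (‖z‖ ^ 2 * a * M / z.re)).neg
    have h2 := (Real.hasDerivAt_rpow_const (p := a - 1) (Or.inl hη0.ne')).const_mul (‖z‖ * a)
    convert! h1.sub h2 using 1
    simp only [hG']
    field_simp
    ring
  have hGc : ContinuousOn G' (uIcc (1 / x) R) := by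
    have h : ∀ q : ℝ, ContinuousOn (fun η : ℝ => η ^ q) (uIcc (1 / x) R) := fun q =>
      continuousOn_id.rpow_const fun η hη => Or.inl (hpos η (hu ▸ hη)).ne'
    have h0 := h a
    have h1 := h (a - 1)
    have h2 := h (a - 1 - 1)
    fun_prop
  have hint : ‖∫ η in (1 / x)..R, expSymbolDeriv2 a z η *
      ((-(Real.cos (x * η) / x) : ℝ) : ℂ)‖ ≤ (G R - G (1 / x)) * (1 / x) := by
    rw [← intervalIntegral.integral_eq_sub_of_hasDerivAt hGd hGc.intervalIntegrable,
      ← intervalIntegral.integral_mul_const]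
    refine intervalIntegral.norm_integral_le_of_norm_le hR (ae_of_all _ fun η hη => ?_)
      (hGc.intervalIntegrable.mul_const _)
    have hη' : η ∈ Icc (1 / x) R := Ioc_subset_Icc_self hη
    have h1 := norm_expSymbolDeriv2_le ha ha1 hz.le (hpos η hη') (hMb η hη')
    rw [norm_mul]
    exact mul_le_mul h1 (hv η) (norm_nonneg _) ((norm_nonneg _).trans h1)
  have hGR : G R ≤ 0 := by
    have hR0 : 0 < R := hx'.trans_le hR
    have h1 : 0 ≤ ‖z‖ ^ 2 * a * M / z.re * Real.exp (-z.re * R ^ a) := by positivity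
    have h2 : 0 ≤ ‖z‖ * a * R ^ (a - 1) := by positivity
    simp only [hG]
    linarith
  have hGx : -G (1 / x) ≤ ‖z‖ ^ 2 * a * M / z.re + ‖z‖ * a * M := by
    have h1 : Real.exp (-z.re * (1 / x) ^ a) ≤ 1 := by
      rw [← norm_expSymbol]; exact norm_expSymbol_le_one hz.le hx'.le
    have h2 : ‖z‖ ^ 2 * a * M / z.re * Real.exp (-z.re * (1 / x) ^ a) ≤
      ‖z‖ ^ 2 * a * M / z.re := mul_le_of_le_one_right (by positivity) h1
    have h3 : ‖z‖ * a * (1 / x) ^ (a - 1) = ‖z‖ * a * M := by rw [inv_rpow_sub_one hx]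
    simp only [hG]
    linarith
  rw [hibp]
  have t1 := norm_sub_le (expSymbolDeriv a z R * ((-(Real.cos (x * R) / x) : ℝ) : ℂ) -
    expSymbolDeriv a z (1 / x) * ((-(Real.cos (x * (1 / x)) / x) : ℝ) : ℂ))
    (∫ η in (1 / x)..R, expSymbolDeriv2 a z η * ((-(Real.cos (x * η) / x) : ℝ) : ℂ))
  have t2 := norm_sub_le (expSymbolDeriv a z R * ((-(Real.cos (x * R) / x) : ℝ) : ℂ))
    (expSymbolDeriv a z (1 / x) * ((-(Real.cos (x * (1 / x)) / x) : ℝ) : ℂ))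
  have t3 := hbd R (right_mem_Icc.2 hR)
  have t4 := hbd (1 / x) (left_mem_Icc.2 hR)
  have t5 : (G R - G (1 / x)) * (1 / x) ≤
      (‖z‖ ^ 2 * a * M / z.re + ‖z‖ * a * M) * (1 / x) := by gcongr; linarith
  have t6 : M * (1 / x) = x ^ (-a) := by
    rw [hM, show (-a) = 1 - a - 1 by ring, Real.rpow_sub_one hx.ne']; ring
  have t7 : ‖z‖ * a ≤ κ ^ 2 * z.re := by
    calc ‖z‖ * a ≤ κ * z.re * 1 := by gcongr
      _ = κ * 1 * z.re := by ring
      _ ≤ κ * κ * z.re := by gcongr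
      _ = _ := by ring
  have t8 : ‖z‖ ^ 2 * a / z.re ≤ κ ^ 2 * z.re := by
    rw [div_le_iff₀ hz]
    calc ‖z‖ ^ 2 * a ≤ (κ * z.re) ^ 2 * 1 := by gcongr
      _ = _ := by ring
  have hxa : 0 < x ^ (-a) := by positivity
  calc _ ≤ ‖z‖ * a * M * (1 / x) + ‖z‖ * a * M * (1 / x) +
        (‖z‖ ^ 2 * a * M / z.re + ‖z‖ * a * M) * (1 / x) := by linarith
    _ = (3 * (‖z‖ * a) + ‖z‖ ^ 2 * a / z.re) * (M * (1 / x)) := by ring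
    _ ≤ (3 * (κ ^ 2 * z.re) + κ ^ 2 * z.re) * (M * (1 / x)) := by gcongr
    _ = _ := by rw [t6]; ring

/-- A second integration by parts down to `0` would meet `η^{a-2}`, not integrable there for `a <
1`. The integral is therefore cut at `1/x`: below it absolute values suffice, above it one
integrates by parts. Each side is of order `x^{-a}`, and the first integration by parts supplies the
remaining `1/x`. -/
lemma norm_cosTransform_le_decay (ha : 0 < a) (ha1 : a ≤ 1) {κ : ℝ} (hz : 0 < z.re)
    (hκ : 1 ≤ κ) (hzκ : ‖z‖ ≤ κ * z.re) {x : ℝ} (hx : 0 < x) :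
    ‖cosTransform a z x‖ ≤ 5 * κ ^ 2 * z.re * x ^ (-1 - a) := by
  have hx' : 0 < 1 / x := by positivity
  have hxa : 0 < x ^ (-a) := by positivity
  set F : ℝ → ℂ := fun η => expSymbolDeriv a z η * ((Real.sin (x * η) : ℝ) : ℂ) with hF
  have hFi : IntegrableOn F (Ioi 0) := (integrableOn_expSymbolDeriv ha hz).mul_bdd (c := 1)
    (Continuous.aestronglyMeasurable (by fun_prop)) (ae_of_all _ fun η => by
      rw [Complex.norm_real]; exact Real.abs_sin_le_one _)
  have hFb : ∀ η, ‖F η‖ ≤ ‖expSymbolDeriv a z η‖ := fun η => by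
    rw [hF, norm_mul, Complex.norm_real]
    exact mul_le_of_le_one_right (norm_nonneg _) (Real.abs_sin_le_one _)
  have heq : cosTransform a z x = -((∫ η in Ioi 0, F η) * ((1 / x : ℝ) : ℂ)) := by
    rw [cosTransform_eq ha hz hx, ← integral_mul_const]
    congr 1
    refine integral_congr_ae (ae_of_all _ fun η => ?_)
    simp only [hF]
    push_cast
    ring
  have h1 : ‖∫ η in Ioc 0 (1 / x), F η‖ ≤ κ ^ 2 * z.re * x ^ (-a) := by
    have hi : IntervalIntegrable (fun η : ℝ => ‖z‖ * a * η ^ (a - 1)) volume 0 (1 / x) :=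
      (intervalIntegral.intervalIntegrable_rpow' (by linarith)).const_mul _
    rw [← intervalIntegral.integral_of_le hx'.le]
    refine (intervalIntegral.norm_integral_le_of_norm_le hx'.le (ae_of_all _ fun η hη => ?_)
      hi).trans ?_
    · exact (hFb η).trans (norm_expSymbolDeriv_le ha hz.le hη.1)
    · rw [intervalIntegral.integral_const_mul, integral_rpow (Or.inl (by linarith)),
        sub_add_cancel, Real.zero_rpow ha.ne', sub_zero, one_div, Real.inv_rpow hx.le,
        ← Real.rpow_neg hx.le]
      calc ‖z‖ * a * (x ^ (-a) / a) = ‖z‖ * x ^ (-a) := by field_simp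
        _ ≤ κ * 1 * z.re * x ^ (-a) := by
          rw [mul_one]; gcongr
        _ ≤ κ * κ * z.re * x ^ (-a) := by gcongr
        _ = _ := by ring
  have h2 : ‖∫ η in Ioi (1 / x), F η‖ ≤ 4 * κ ^ 2 * z.re * x ^ (-a) := by
    have hlim := intervalIntegral_tendsto_integral_Ioi (1 / x)
      (hFi.mono_set (Ioi_subset_Ioi hx'.le)) tendsto_id
    refine le_of_tendsto hlim.norm ?_
    filter_upwards [eventually_ge_atTop (1 / x)] with R hR
    exact norm_sineTransform_tail_le ha ha1 hz hκ hzκ hx hR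
  have h3 : ∫ η in Ioi 0, F η = (∫ η in Ioc 0 (1 / x), F η) + ∫ η in Ioi (1 / x), F η := by
    rw [← setIntegral_union (Ioc_disjoint_Ioi le_rfl) measurableSet_Ioi
      (hFi.mono_set Ioc_subset_Ioi_self) (hFi.mono_set (Ioi_subset_Ioi hx'.le)),
      Ioc_union_Ioi_eq_Ioi hx'.le]
  rw [heq, norm_neg, norm_mul, Complex.norm_real, Real.norm_of_nonneg hx'.le, h3]
  have h4 : x ^ (-1 - a) = x ^ (-a) * (1 / x) := by
    rw [show -1 - a = -a - 1 by ring, Real.rpow_sub_one hx.ne']; ring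
  rw [h4, ← mul_assoc]
  gcongr
  refine (norm_add_le _ _).trans ?_
  linarith

/-- The symbol is even, so the Fourier integral folds onto the half line; `1/π` is `2/(2π)`. -/
lemma kernel_eq_cosTransform {γ t : ℝ} (ha : 0 < a) (ht : 0 < t) (x : ℝ) :
    kernel a γ t x = ((1 / Real.pi : ℝ) : ℂ) *
      cosTransform a (((t ^ γ : ℝ) : ℂ) - Complex.I * t) |x| := by
  set z : ℂ := ((t ^ γ : ℝ) : ℂ) - Complex.I * t with hz
  have hsym : ∀ η : ℝ, symbol a γ t η = expSymbol a z |η| := fun η => by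
    rw [symbol, expSymbol, hz]
    congr 1
    push_cast
    ring
  set g : ℝ → ℂ := fun η => symbol a γ t η * Complex.exp (Complex.I * ((x * η : ℝ) : ℂ)) with hg
  have hgi : Integrable g := by
    have h0 : Continuous g := by
      have := continuous_symbol ha γ t
      fun_prop
    refine Integrable.mono' (integrable_exp_neg_abs_rpow ha (Real.rpow_pos_of_pos ht γ))
      h0.aestronglyMeasurable (ae_of_all _ fun η => ?_)
    rw [hg, norm_mul, norm_cexp_I_mul, mul_one, norm_symbol]
  have h1 : kernel a γ t x = ((2 * Real.pi)⁻¹ : ℝ) • ∫ η, g η := by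
    have h := Measure.integral_comp_mul_left g (2 * Real.pi)
    rw [abs_of_pos (inv_pos.2 Real.two_pi_pos)] at h
    rw [← h, kernel]
    refine integral_congr_ae (ae_of_all _ fun ξ => ?_)
    simp only [hg]
    congr 2
    push_cast
    ring
  have h2 : ∫ η, g η = ∫ η in Ioi (0 : ℝ), (g η + g (-η)) := by
    have hneg : IntegrableOn (fun η => g (-η)) (Ioi 0) := hgi.comp_neg.integrableOn
    rw [integral_add hgi.integrableOn hneg, integral_comp_neg_Ioi, neg_zero, add_comm,
      ← setIntegral_union (Iic_disjoint_Ioi le_rfl) measurableSet_Ioi hgi.integrableOn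
        hgi.integrableOn, Iic_union_Ioi, setIntegral_univ]
  have h3 : ∫ η in Ioi (0 : ℝ), (g η + g (-η)) = 2 * cosTransform a z |x| := by
    rw [cosTransform, ← integral_const_mul]
    refine setIntegral_congr_fun measurableSet_Ioi fun η hη => ?_
    have hη' : |η| = η := abs_of_pos hη
    simp only [hg, hsym, abs_neg, hη']
    have hcos : Real.cos (|x| * η) = Real.cos (x * η) := by
      rcases abs_choice x with h | h <;> rw [h]
      rw [neg_mul, Real.cos_neg]
    rw [hcos, Complex.ofReal_cos, Complex.cos]
    push_cast
    rw [show Complex.I * ((x : ℂ) * -η) = -(x * η) * Complex.I by ring,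
      show Complex.I * ((x : ℂ) * η) = x * η * Complex.I by ring]
    ring
  rw [h1, h2, h3, Complex.real_smul]
  push_cast
  have : (Real.pi : ℂ) ≠ 0 := by exact_mod_cast Real.pi_ne_zero
  field_simp

/-- Size and decay of the kernel at the scale `t^{γ/a}`. -/
lemma exists_norm_kernel_le (ha : 0 < a) (ha1 : a ≤ 1) :
    ∃ C : ℝ, 0 ≤ C ∧ ∀ {γ t κ : ℝ}, 0 < t → 0 ≤ κ → t ≤ κ * t ^ γ →
      (∀ x, ‖kernel a γ t x‖ ≤ C * (1 + κ) ^ 2 * ((t ^ γ) ^ (1 / a))⁻¹) ∧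
      (∀ x, x ≠ 0 → ‖kernel a γ t x‖ ≤
        C * (1 + κ) ^ 2 * (((t ^ γ) ^ (1 / a)) ^ a * |x| ^ (-1 - a))) := by
  have hΓ : 0 ≤ 1 / a * Real.Gamma (1 / a) :=
    mul_nonneg (by positivity) (Real.Gamma_nonneg_of_nonneg (by positivity))
  refine ⟨1 / a * Real.Gamma (1 / a) + 5, by linarith, fun {γ t κ} ht hκ htκ => ?_⟩
  set z : ℂ := ((t ^ γ : ℝ) : ℂ) - Complex.I * t with hz
  set b := t ^ γ with hb
  have hb0 : 0 < b := by positivity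
  have hzre : z.re = b := by simp [hz]
  -- The relation `t ≤ κ t^γ` confines the complex time to a sector in the right half plane, which
  -- makes the bounds uniform.
  have hzn : ‖z‖ ≤ (1 + κ) * z.re := by
    rw [hzre]
    refine (norm_sub_le _ _).trans ?_
    rw [Complex.norm_real, norm_mul, Complex.norm_I, one_mul, Complex.norm_real,
      Real.norm_of_nonneg hb0.le, Real.norm_of_nonneg ht.le]
    linarith
  have hpi : 1 / Real.pi ≤ 1 := by
    rw [div_le_one Real.pi_pos]; linarith [Real.pi_gt_three]
  have hK : ∀ x, ‖kernel a γ t x‖ ≤ ‖cosTransform a z |x|‖ := fun x => by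
    rw [kernel_eq_cosTransform ha ht, norm_mul, Complex.norm_real,
      Real.norm_of_nonneg (by positivity)]
    exact mul_le_of_le_one_left (norm_nonneg _) hpi
  have hκ1 : 1 ≤ (1 + κ) ^ 2 := by nlinarith
  have hz0 : 0 < z.re := by rw [hzre]; exact hb0
  constructor
  · intro x
    refine (hK x).trans ((norm_cosTransform_le ha hz0 _).trans ?_)
    rw [hzre, Real.rpow_neg hb0.le]
    refine mul_le_mul_of_nonneg_right ?_ (by positivity)
    nlinarith
  · intro x hx
    refine (hK x).trans ((norm_cosTransform_le_decay ha ha1 hz0 (by linarith) hzn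
      (abs_pos.2 hx)).trans ?_)
    rw [hzre, ← Real.rpow_mul hb0.le, one_div_mul_cancel ha.ne', Real.rpow_one]
    have h0 : 0 ≤ (1 + κ) ^ 2 * (b * |x| ^ (-1 - a)) := by positivity
    nlinarith [mul_nonneg hΓ h0]

end KernelDecay


/-! ### Approximate identities at Lebesgue points. -/

section ApproximateIdentity

open Set Metric

variable {a A l : ℝ} {k : ℝ → ℂ}

/-- A kernel of size `1/l` on `|x| ≤ l` with decay `|x|^{-1-a}` is dominated by a geometric series
of normalised indicators of balls. -/
lemma enorm_kernel_le_tsum (ha : 0 < a) (hl : 0 < l) (hA : 0 ≤ A)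
    (h1 : ∀ x, ‖k x‖ ≤ A * l⁻¹) (h2 : ∀ x, x ≠ 0 → ‖k x‖ ≤ A * (l ^ a * |x| ^ (-1 - a)))
    (x y : ℝ) : ‖k (x - y)‖ₑ ≤ ∑' j : ℕ, ENNReal.ofReal (A * 2 ^ (1 + a) *
      ((2 ^ j : ℝ) ^ (-1 - a) * l⁻¹)) * (closedBall x (2 ^ j * l)).indicator 1 y := by
  have h21 : (1 : ℝ) ≤ 2 ^ (1 + a) := Real.one_le_rpow (by norm_num) (by linarith)
  suffices h : ∃ j : ℕ, |x - y| ≤ 2 ^ j * l ∧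
      ‖k (x - y)‖ ≤ A * 2 ^ (1 + a) * ((2 ^ j : ℝ) ^ (-1 - a) * l⁻¹) by
    obtain ⟨j, hj, hk⟩ := h
    refine le_trans ?_ (ENNReal.le_tsum j)
    have hmem : y ∈ closedBall x (2 ^ j * l) := by
      rw [mem_closedBall, dist_comm, Real.dist_eq]; exact hj
    rw [indicator_of_mem hmem, Pi.one_apply, mul_one, ← ofReal_norm]
    exact ENNReal.ofReal_le_ofReal hk
  rcases le_or_gt |x - y| l with h | h
  · refine ⟨0, by simpa using h, (h1 _).trans ?_⟩
    rw [pow_zero, Real.one_rpow, one_mul]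
    have : A ≤ A * 2 ^ (1 + a) := le_mul_of_one_le_right hA h21
    gcongr
  · obtain ⟨n, hn1, hn2⟩ := exists_nat_pow_near (x := |x - y| / l) (y := 2)
      (by rw [le_div_iff₀ hl]; linarith) (by norm_num)
    rw [le_div_iff₀ hl] at hn1
    rw [div_lt_iff₀ hl] at hn2
    -- The decay is evaluated at the inner radius `2^n l` but the ball has the outer radius `2^{n+1}
    -- l`; the factor `2^{1+a}` pays for the shift.
    refine ⟨n + 1, hn2.le, (h2 _ fun h0 => ?_).trans ?_⟩
    · rw [h0, abs_zero] at h; linarith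
    · have h3 : |x - y| ^ (-1 - a) ≤ (2 ^ n * l) ^ (-1 - a) :=
        Real.rpow_le_rpow_of_nonpos (by positivity) hn1 (by linarith)
      calc A * (l ^ a * |x - y| ^ (-1 - a)) ≤ A * (l ^ a * (2 ^ n * l) ^ (-1 - a)) := by gcongr
        _ = A * ((2 ^ n : ℝ) ^ (-1 - a) * l⁻¹) := by
          rw [Real.mul_rpow (by positivity) hl.le]
          have : l ^ a * l ^ (-1 - a) = l⁻¹ := by
            rw [← Real.rpow_add hl, ← Real.rpow_neg_one]; ring_nf
          rw [← this]; ring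
        _ = _ := by
          rw [pow_succ, Real.mul_rpow (by positivity) (by norm_num)]
          have : (2 : ℝ) ^ (1 + a) * 2 ^ (-1 - a) = 1 := by
            rw [← Real.rpow_add (by norm_num)]; ring_nf; simp
          calc _ = A * (2 ^ n : ℝ) ^ (-1 - a) * l⁻¹ * (2 ^ (1 + a) * 2 ^ (-1 - a)) := by
                rw [this]; ring
            _ = _ := by ring

lemma lintegral_kernel_mul_le (ha : 0 < a) (hl : 0 < l) (hA : 0 ≤ A)
    (h1 : ∀ x, ‖k x‖ ≤ A * l⁻¹) (h2 : ∀ x, x ≠ 0 → ‖k x‖ ≤ A * (l ^ a * |x| ^ (-1 - a)))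
    {h : ℝ → ℝ≥0∞} (hh : Measurable h) (x : ℝ) :
    ∫⁻ y, ‖k (x - y)‖ₑ * h y ≤ ∑' j : ℕ, ENNReal.ofReal (A * 2 ^ (1 + a) *
      ((2 ^ j : ℝ) ^ (-1 - a) * l⁻¹)) * ∫⁻ y in closedBall x (2 ^ j * l), h y := by
  have hm : ∀ j : ℕ, Measurable fun y =>
      (closedBall x (2 ^ j * l)).indicator (1 : ℝ → ℝ≥0∞) y * h y := fun j =>
    (measurable_one.indicator measurableSet_closedBall).mul hh
  calc _ ≤ ∫⁻ y, ∑' j : ℕ, ENNReal.ofReal (A * 2 ^ (1 + a) *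
      ((2 ^ j : ℝ) ^ (-1 - a) * l⁻¹)) *
        ((closedBall x (2 ^ j * l)).indicator 1 y * h y) := by
        refine lintegral_mono fun y => ?_
        simp_rw [← mul_assoc]
        rw [ENNReal.tsum_mul_right]
        gcongr
        simpa only [← mul_assoc] using enorm_kernel_le_tsum ha hl hA h1 h2 x y
    _ = _ := by
        rw [lintegral_tsum fun j => ((hm j).const_mul _).aemeasurable]
        congr 1 with j
        rw [lintegral_const_mul _ (hm j), ← lintegral_indicator measurableSet_closedBall]
        congr 1
        refine lintegral_congr fun y => ?_
        by_cases hy : y ∈ closedBall x (2 ^ j * l) <;> simp [hy]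

lemma two_pow_rpow_neg_eq (a : ℝ) (j : ℕ) :
    (2 ^ j : ℝ) ^ (-1 - a) * 2 ^ j = (2 ^ (-a)) ^ j := by
  rw [← two_pow_rpow, ← Real.rpow_add_one (by positivity)]
  ring_nf

lemma summable_two_rpow_neg (ha : 0 < a) : Summable fun j : ℕ => ((2 : ℝ) ^ (-a)) ^ j :=
  summable_geometric_of_lt_one (by positivity)
    (Real.rpow_lt_one_of_one_lt_of_neg (by norm_num) (by linarith))

/-- The mean oscillation of `f` about its value at `x`. -/
noncomputable def meanOsc (f : ℝ → ℂ) (x r : ℝ) : ℝ := ⨍ y in closedBall x r, ‖f y - f x‖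

lemma meanOsc_nonneg (f : ℝ → ℂ) (x r : ℝ) : 0 ≤ meanOsc f x r := by
  rw [meanOsc, average_eq, smul_eq_mul]
  exact mul_nonneg (by positivity) (integral_nonneg fun y => norm_nonneg _)

lemma integral_eq_meanOsc (f : ℝ → ℂ) (x : ℝ) {r : ℝ} (hr : 0 < r) :
    ∫ y in closedBall x r, ‖f y - f x‖ = 2 * r * meanOsc f x r := by
  rw [meanOsc, setAverage_eq, Measure.real, Real.volume_closedBall,
    ENNReal.toReal_ofReal (by linarith), smul_eq_mul, ← mul_assoc,
    mul_inv_cancel₀ (by linarith), one_mul]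

/-- The volume of the `j`-th ball cancels all of its weight but `2^{-aj}`, leaving a geometrically
weighted series of mean oscillations at the radii `2^j l`. -/
lemma norm_integral_kernel_sub_le (ha : 0 < a) (hl : 0 < l) (hA : 0 ≤ A)
    (h1 : ∀ x, ‖k x‖ ≤ A * l⁻¹) (h2 : ∀ x, x ≠ 0 → ‖k x‖ ≤ A * (l ^ a * |x| ^ (-1 - a)))
    {f : ℝ → ℂ} (hf : Measurable f) (hfl : LocallyIntegrable f) {x D : ℝ}
    (hD : ∀ r, 0 < r → meanOsc f x r ≤ D) :
    ‖∫ y, k (x - y) * (f y - f x)‖ ≤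
      ∑' j : ℕ, 2 * A * 2 ^ (1 + a) * ((2 ^ (-a)) ^ j * meanOsc f x (2 ^ j * l)) := by
  have hs : Summable fun j : ℕ =>
      2 * A * 2 ^ (1 + a) * ((2 ^ (-a)) ^ j * meanOsc f x (2 ^ j * l)) := by
    refine Summable.mul_left _ (Summable.of_nonneg_of_le
      (fun j => mul_nonneg (by positivity) (meanOsc_nonneg _ _ _)) (fun j => ?_)
      ((summable_two_rpow_neg ha).mul_right D))
    gcongr
    exact hD _ (by positivity)
  have hnn : ∀ j : ℕ, 0 ≤ 2 * A * 2 ^ (1 + a) * ((2 ^ (-a)) ^ j * meanOsc f x (2 ^ j * l)) :=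
    fun j => mul_nonneg (by positivity) (mul_nonneg (by positivity) (meanOsc_nonneg _ _ _))
  rw [← ENNReal.ofReal_le_ofReal_iff (tsum_nonneg hnn), ENNReal.ofReal_tsum_of_nonneg hnn hs,
    ofReal_norm]
  refine (enorm_integral_le_lintegral_enorm _).trans ?_
  simp_rw [enorm_mul]
  refine (lintegral_kernel_mul_le ha hl hA h1 h2 (hf.sub_const (f x)).enorm x).trans
    (ENNReal.tsum_le_tsum fun j => ?_)
  have hr : 0 < 2 ^ j * l := by positivity
  have hi : IntegrableOn (fun y => ‖f y - f x‖) (closedBall x (2 ^ j * l)) :=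
    ((hfl.integrableOn_isCompact (isCompact_closedBall _ _)).sub
      (integrableOn_const (measure_closedBall_lt_top).ne)).norm
  have h3 : ∫⁻ y in closedBall x (2 ^ j * l), ‖f y - f x‖ₑ =
      ENNReal.ofReal (2 * (2 ^ j * l) * meanOsc f x (2 ^ j * l)) := by
    rw [← integral_eq_meanOsc f x hr,
      ofReal_integral_eq_lintegral_ofReal hi (ae_of_all _ fun y => norm_nonneg _)]
    simp_rw [ofReal_norm]
  rw [h3, ← ENNReal.ofReal_mul (by positivity), ← two_pow_rpow_neg_eq a]
  refine ENNReal.ofReal_le_ofReal (le_of_eq ?_)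
  field_simp

/-- A substitute for Hölder's inequality: against an integrable and bounded kernel, the constant
uses integrability and the power uses boundedness. -/
lemma norm_le_one_add_rpow {p : ℝ} (hp : 1 ≤ p) (u : ℂ) : ‖u‖ ≤ 1 + ‖u‖ ^ p := by
  rcases le_total ‖u‖ 1 with h | h
  · exact h.trans (le_add_of_nonneg_right (by positivity))
  · have : ‖u‖ ^ (1 : ℝ) ≤ ‖u‖ ^ p := Real.rpow_le_rpow_of_exponent_le h hp
    rw [Real.rpow_one] at this
    linarith

/-- At a Lebesgue point the mean oscillation is bounded over all radii. -/
lemma exists_meanOsc_le {f : ℝ → ℂ} {p : ℝ} (hp : 1 ≤ p)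
    (hfp : Integrable fun y => ‖f y‖ ^ p) (hfl : LocallyIntegrable f) {x : ℝ}
    (hx : Tendsto (meanOsc f x) (𝓝[>] 0) (𝓝 0)) : ∃ D, ∀ r, 0 < r → meanOsc f x r ≤ D := by
  obtain ⟨ρ, hρ, hρ1⟩ := (mem_nhdsGT_iff_exists_Ioo_subset).1
    (hx.eventually (eventually_le_nhds (zero_lt_one' ℝ)))
  set F := ∫ y, ‖f y‖ ^ p with hF
  have hF0 : 0 ≤ F := integral_nonneg fun y => by positivity
  have hρ0 : (0 : ℝ) < ρ := hρ
  -- Radii below `ρ` are controlled by the Lebesgue point, larger ones by the `L^p` norm.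
  refine ⟨max 1 (1 + F / (2 * ρ) + ‖f x‖), fun r hr => ?_⟩
  rcases lt_or_ge r ρ with h | h
  · exact (hρ1 ⟨hr, h⟩ : meanOsc f x r ≤ 1).trans (le_max_left _ _)
  · refine le_trans ?_ (le_max_right _ _)
    have hvol : volume.real (closedBall x r) = 2 * r := by
      rw [Measure.real, Real.volume_closedBall, ENNReal.toReal_ofReal (by linarith)]
    have hc : ∀ c : ℝ, IntegrableOn (fun _ : ℝ => c) (closedBall x r) := fun c =>
      integrableOn_const (measure_closedBall_lt_top).ne
    have hi : IntegrableOn (fun y => ‖f y - f x‖) (closedBall x r) :=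
      ((hfl.integrableOn_isCompact (isCompact_closedBall _ _)).sub
        (integrableOn_const (measure_closedBall_lt_top).ne)).norm
    have h1 : ∫ y in closedBall x r, ‖f y - f x‖ ≤
        ∫ y in closedBall x r, ((1 + ‖f x‖) + ‖f y‖ ^ p) := by
      refine integral_mono hi ((hc _).add hfp.integrableOn) fun y => ?_
      have := norm_sub_le (f y) (f x)
      have := norm_le_one_add_rpow hp (f y)
      dsimp only
      linarith
    rw [integral_eq_meanOsc f x hr, integral_add (hc _) hfp.integrableOn, setIntegral_const, hvol,
      smul_eq_mul] at h1
    have h2 : ∫ y in closedBall x r, ‖f y‖ ^ p ≤ F :=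
      setIntegral_le_integral hfp (ae_of_all _ fun y => by positivity)
    have h3 : F / (2 * r) ≤ F / (2 * ρ) := by gcongr
    have h4 : meanOsc f x r ≤ (1 + ‖f x‖) + F / (2 * r) := by
      have : (0 : ℝ) < 2 * r := by linarith
      rw [← mul_le_mul_iff_right₀ this, mul_add, mul_div_cancel₀ _ this.ne']
      linarith
    linarith

/-- The same dyadic majorant, tested on the constant 1, sums to a geometric series. -/
lemma integrable_of_kernel_bound (ha : 0 < a) (hl : 0 < l) (hA : 0 ≤ A) (hk : Continuous k)
    (h1 : ∀ x, ‖k x‖ ≤ A * l⁻¹) (h2 : ∀ x, x ≠ 0 → ‖k x‖ ≤ A * (l ^ a * |x| ^ (-1 - a))) :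
    Integrable k := by
  have hfin : ∫⁻ y, ‖k (0 - y)‖ₑ * 1 < ∞ := by
    refine (lintegral_kernel_mul_le ha hl hA h1 h2 measurable_const 0).trans_lt ?_
    have hj : ∀ j : ℕ, ENNReal.ofReal (A * 2 ^ (1 + a) * ((2 ^ j : ℝ) ^ (-1 - a) * l⁻¹)) *
        ∫⁻ y in closedBall (0 : ℝ) (2 ^ j * l), (1 : ℝ≥0∞) =
        ENNReal.ofReal (2 * A * 2 ^ (1 + a) * (2 ^ (-a)) ^ j) := fun j => by
      rw [setLIntegral_one, Real.volume_closedBall, ← ENNReal.ofReal_mul (by positivity),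
        ← two_pow_rpow_neg_eq a]
      congr 1
      field_simp
    simp_rw [hj]
    rw [← ENNReal.ofReal_tsum_of_nonneg (fun j => by positivity)
      ((summable_two_rpow_neg ha).mul_left _)]
    exact ENNReal.ofReal_lt_top
  have h : Integrable fun y => k (-y) := by
    refine ⟨Continuous.aestronglyMeasurable (by fun_prop), ?_⟩
    simpa [HasFiniteIntegral] using hfin
  simpa using h.comp_neg

lemma integrable_kernel_mul {p : ℝ} (hp : 1 ≤ p) {f : ℝ → ℂ} (hf : AEStronglyMeasurable f)
    (hfp : Integrable fun y => ‖f y‖ ^ p) (hk : Integrable k) {B : ℝ} (hB : ∀ x, ‖k x‖ ≤ B)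
    (x : ℝ) : Integrable fun y => k (x - y) * f y := by
  have hk' : Integrable fun y => k (x - y) := hk.comp_sub_left x
  refine Integrable.mono' (hk'.norm.add (hfp.const_mul B))
    (hk'.aestronglyMeasurable.mul hf) (ae_of_all _ fun y => ?_)
  rw [norm_mul]
  have h1 := norm_le_one_add_rpow hp (f y)
  calc ‖k (x - y)‖ * ‖f y‖ ≤ ‖k (x - y)‖ * (1 + ‖f y‖ ^ p) := by gcongr
    _ = ‖k (x - y)‖ + ‖k (x - y)‖ * ‖f y‖ ^ p := by ring
    _ ≤ ‖k (x - y)‖ + B * ‖f y‖ ^ p := by gcongr; exact hB _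

/-- Convergence of an approximate identity at a Lebesgue point. -/
lemma tendsto_approximate_identity (ha : 0 < a) {ι : Type*} {F : Filter ι} {K : ι → ℝ → ℂ}
    {L : ι → ℝ} (hA : 0 ≤ A) (hL0 : ∀ᶠ i in F, 0 < L i) (hL : Tendsto L F (𝓝 0))
    (hint : ∀ᶠ i in F, Integrable (K i)) (hone : ∀ᶠ i in F, ∫ y, K i y = 1)
    (h1 : ∀ᶠ i in F, ∀ x, ‖K i x‖ ≤ A * (L i)⁻¹)
    (h2 : ∀ᶠ i in F, ∀ x, x ≠ 0 → ‖K i x‖ ≤ A * ((L i) ^ a * |x| ^ (-1 - a)))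
    {p : ℝ} (hp : 1 ≤ p) {f : ℝ → ℂ} (hf : Measurable f)
    (hfp : Integrable fun y => ‖f y‖ ^ p) (hfl : LocallyIntegrable f) {x : ℝ}
    (hx : Tendsto (meanOsc f x) (𝓝[>] 0) (𝓝 0)) :
    Tendsto (fun i => ∫ y, K i (x - y) * f y) F (𝓝 (f x)) := by
  obtain ⟨D, hD⟩ := exists_meanOsc_le hp hfp hfl hx
  -- For fixed `j` the radius `2^j L i` shrinks to `0` and the oscillation with it; the bound `D`
  -- over all radii dominates the series.
  have hlim : Tendsto (fun i => ∑' j : ℕ, 2 * A * 2 ^ (1 + a) *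
      ((2 ^ (-a)) ^ j * meanOsc f x (2 ^ j * L i))) F (𝓝 (∑' _ : ℕ, (0 : ℝ))) := by
    refine tendsto_tsum_of_dominated_convergence
      (bound := fun j : ℕ => 2 * A * 2 ^ (1 + a) * ((2 ^ (-a)) ^ j * D))
      (((summable_two_rpow_neg ha).mul_right D).mul_left _) (fun j => ?_) ?_
    · have h3 : Tendsto (fun i => 2 ^ j * L i) F (𝓝[>] 0) := by
        refine tendsto_nhdsWithin_iff.2 ⟨by simpa using hL.const_mul (2 ^ j : ℝ), ?_⟩
        filter_upwards [hL0] with i hi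
        exact mul_pos (by positivity) hi
      simpa using ((hx.comp h3).const_mul ((2 ^ (-a) : ℝ) ^ j)).const_mul (2 * A * 2 ^ (1 + a))
    · filter_upwards [hL0] with i hi j
      have h4 := meanOsc_nonneg f x (2 ^ j * L i)
      have h5 := hD (2 ^ j * L i) (by positivity)
      rw [Real.norm_of_nonneg (by positivity)]
      gcongr
  rw [tsum_zero] at hlim
  rw [tendsto_iff_norm_sub_tendsto_zero]
  refine squeeze_zero' (Eventually.of_forall fun i => norm_nonneg _) ?_ hlim
  filter_upwards [hL0, hint, hone, h1, h2] with i hi hint hone h1 h2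
  have h3 : (∫ y, K i (x - y) * f y) - f x = ∫ y, K i (x - y) * (f y - f x) := by
    have h4 : ∫ y, K i (x - y) * f x = f x := by
      rw [integral_mul_const, integral_sub_left_eq_self (K i), hone, one_mul]
    simp_rw [mul_sub]
    rw [integral_sub (integrable_kernel_mul hp hf.aestronglyMeasurable hfp hint h1 x)
      ((hint.comp_sub_left x).mul_const _), h4]
  rw [h3]
  exact norm_integral_kernel_sub_le ha hi hA h1 h2 hf hfl hD

end ApproximateIdentity

/-! ### The kernel as an approximate identity and convergence for `L^p` data. -/

section Kernel

lemma kernel_eq_fourierInv (a γ t : ℝ) :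
    kernel a γ t = 𝓕⁻ fun ξ : ℝ => symbol a γ t (2 * Real.pi * ξ) := by
  ext x
  rw [Real.fourierInv_eq', kernel]
  refine integral_congr_ae (ae_of_all _ fun ξ => ?_)
  simp only [smul_eq_mul]
  rw [mul_comm]
  congr 2
  simp
  ring

lemma integrable_symbol {a γ t : ℝ} (ha : 0 < a) (ht : 0 < t) :
    Integrable fun ξ : ℝ => symbol a γ t (2 * Real.pi * ξ) := by
  simpa using! memLp_one_iff_integrable.1 (symbol_wave (γ := γ) ha ht 0 1 (Or.inl rfl))

lemma continuous_kernel {a γ t : ℝ} (ha : 0 < a) (ht : 0 < t) : Continuous (kernel a γ t) := by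
  rw [kernel_eq_fourierInv, Real.fourierInv_eq_fourier_comp_neg]
  exact VectorFourier.fourierIntegral_continuous Real.continuous_fourierChar
    continuous_inner (integrable_symbol ha ht).comp_neg

lemma integrable_kernel {a γ t : ℝ} (ha : 0 < a) (ha1 : a ≤ 1) (ht : 0 < t) :
    Integrable (kernel a γ t) := by
  obtain ⟨C, hC, H⟩ := exists_norm_kernel_le ha ha1
  have htg : 0 < t ^ γ := by positivity
  -- At a fixed time no uniformity is needed, so the ratio itself serves as `κ`, for every `γ`.
  obtain ⟨h1, h2⟩ := H (γ := γ) (κ := t / t ^ γ) ht (by positivity)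
    (by rw [div_mul_cancel₀ _ htg.ne'])
  exact integrable_of_kernel_bound ha (by positivity) (by positivity) (continuous_kernel ha ht)
    h1 h2

/-- Fourier inversion at frequency `0`, where the symbol is 1; it applies because the kernel is
integrable. -/
lemma integral_kernel {a γ t : ℝ} (ha : 0 < a) (ha1 : a ≤ 1) (ht : 0 < t) :
    ∫ x, kernel a γ t x = 1 := by
  set S : ℝ → ℂ := fun ξ => symbol a γ t (2 * Real.pi * ξ) with hS
  have hc : Continuous S := by
    have := continuous_symbol ha γ t
    fun_prop
  have hi : Integrable (𝓕⁻ S) := by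
    rw [hS, ← kernel_eq_fourierInv]; exact integrable_kernel ha ha1 ht
  have hS' : Integrable (𝓕 S) := by
    have hev : (fun x => S (-x)) = S := by
      ext ξ
      simp [hS, symbol, abs_mul]
    rwa [Real.fourierInv_eq_fourier_comp_neg, hev] at hi
  have h := congrFun (hc.fourier_fourierInv_eq (integrable_symbol ha ht) hS') 0
  rw [Real.fourier_eq'] at h
  simp only [inner_zero_right, mul_zero, Complex.ofReal_zero, zero_mul, Complex.exp_zero,
    one_smul] at h
  rw [kernel_eq_fourierInv, h]
  simp [hS, symbol, Real.zero_rpow ha.ne']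

lemma integrable_norm_rpow {p : ℝ≥0∞} (hp : 1 ≤ p) (hp' : p ≠ ∞)
    (f : Lp ℂ p (volume : Measure ℝ)) : Integrable fun y => ‖f y‖ ^ p.toReal :=
  (Lp.memLp f).integrable_norm_rpow (zero_lt_one.trans_le hp).ne' hp'

lemma integrable_op {a γ t : ℝ} (ha : 0 < a) (ha1 : a ≤ 1) (ht : 0 < t) {p : ℝ≥0∞} (hp : 1 ≤ p)
    (hp' : p ≠ ∞) (f : Lp ℂ p (volume : Measure ℝ)) (x : ℝ) :
    Integrable fun y : ℝ => kernel a γ t (x - y) * f y := by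
  obtain ⟨C, hC, H⟩ := exists_norm_kernel_le ha ha1
  have htg : 0 < t ^ γ := by positivity
  obtain ⟨h1, -⟩ := H (γ := γ) (κ := t / t ^ γ) ht (by positivity)
    (by rw [div_mul_cancel₀ _ htg.ne'])
  have hp1 : 1 ≤ p.toReal := by
    rw [← ENNReal.toReal_one]; exact ENNReal.toReal_mono hp' hp
  exact integrable_kernel_mul hp1 (Lp.aestronglyMeasurable f) (integrable_norm_rpow hp hp' f)
    (integrable_kernel ha ha1 ht) h1 x

/-- Pointwise convergence for `L^p` functions. -/
lemma ae_tendsto_op {a γ : ℝ} (ha : 0 < a) (ha1 : a ≤ 1) (hγ : 0 < γ) (hγ1 : γ ≤ 1) {p : ℝ≥0∞}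
    (hp : 1 ≤ p) (hp' : p ≠ ∞) (f : Lp ℂ p (volume : Measure ℝ)) :
    ∀ᵐ x : ℝ, Tendsto (fun t : ℝ => op a γ t f x) (𝓝[>] 0) (𝓝 (f x)) := by
  have hfl : LocallyIntegrable (f : ℝ → ℂ) := (Lp.memLp f).locallyIntegrable hp
  obtain ⟨C, hC, H⟩ := exists_norm_kernel_le ha ha1
  have hp1 : 1 ≤ p.toReal := by
    rw [← ENNReal.toReal_one]; exact ENNReal.toReal_mono hp' hp
  have hsmall : ∀ᶠ t : ℝ in 𝓝[>] 0, 0 < t ∧ t ≤ 1 := by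
    filter_upwards [self_mem_nhdsWithin,
      mem_nhdsWithin_of_mem_nhds (Iic_mem_nhds zero_lt_one)] with t h1 h2 using ⟨h1, h2⟩
  have hb : ∀ᶠ t : ℝ in 𝓝[>] 0,
      (∀ x, ‖kernel a γ t x‖ ≤ C * (1 + 1) ^ 2 * ((t ^ γ) ^ (1 / a))⁻¹) ∧
      (∀ x, x ≠ 0 → ‖kernel a γ t x‖ ≤
        C * (1 + 1) ^ 2 * (((t ^ γ) ^ (1 / a)) ^ a * |x| ^ (-1 - a))) := by
    -- Here `γ ≤ 1` enters: `t ≤ t^γ` for `t ≤ 1`, so `κ = 1` works for all small times.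
    filter_upwards [hsmall] with t ht
    refine H ht.1 zero_le_one ?_
    rw [one_mul]
    conv_lhs => rw [← Real.rpow_one t]
    exact Real.rpow_le_rpow_of_exponent_ge ht.1 ht.2 hγ1
  have hL : Tendsto (fun t : ℝ => (t ^ γ) ^ (1 / a)) (𝓝[>] 0) (𝓝 0) := by
    have hc : Continuous fun t : ℝ => (t ^ γ) ^ (1 / a) :=
      (Real.continuous_rpow_const hγ.le).rpow_const fun _ => Or.inr (by positivity)
    have := (hc.tendsto 0).mono_left (nhdsWithin_le_nhds (s := Set.Ioi 0))
    rwa [Real.zero_rpow hγ.ne', Real.zero_rpow (by positivity)] at this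
  -- Lebesgue differentiation; the balls used are centred at `x`, so the dilation factor 1 is
  -- harmless.
  filter_upwards [IsUnifLocDoublingMeasure.ae_tendsto_average_norm_sub volume hfl 1] with x hx
  refine tendsto_approximate_identity (K := fun t => kernel a γ t) ha
    (A := C * (1 + 1) ^ 2) (by positivity)
    (hsmall.mono fun t ht => by have := ht.1; positivity) hL
    (hsmall.mono fun t ht => integrable_kernel ha ha1 ht.1)
    (hsmall.mono fun t ht => integral_kernel ha ha1 ht.1) (hb.mono fun t ht => ht.1)
    (hb.mono fun t ht => ht.2) hp1 (Lp.stronglyMeasurable f).measurable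
    (integrable_norm_rpow hp hp' f) hfl ?_
  refine hx (fun _ => x) id tendsto_id ?_
  filter_upwards [self_mem_nhdsWithin] with r hr
  have : (0 : ℝ) < r := hr
  simpa using this.le

end Kernel

end FracSchrodinger

theorem corollary1p2 (a : ℝ) (ha0 : 0 < a) (ha1 : a ≤ 1) :
    (∀ γ : ℝ, 0 < γ → γ ≤ 1 → ∀ p : ℝ≥0∞, 1 ≤ p → p ≠ ∞ → ∀ f : Lp ℂ p (volume : Measure ℝ),
      (∀ t : ℝ, 0 < t → ∀ x : ℝ,
        Integrable (fun y : ℝ => FracSchrodinger.kernel a γ t (x - y) * f y)) ∧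
      ∀ᵐ x : ℝ, Tendsto (fun t : ℝ => FracSchrodinger.op a γ t f x) (𝓝[>] 0) (𝓝 (f x))) ∧
    (∀ γ : ℝ, 1 < γ → ∀ s : ℝ,
      (a < 1 → a / 4 * (1 - 1 / γ) < s) → (a = 1 → 1 / 2 * (1 - 1 / γ) < s) →
      ∀ f : Lp ℂ 2 (volume : Measure ℝ), TemperedDistribution.MemSobolev s 2 (f : 𝓢'(ℝ, ℂ)) →
      (∀ t : ℝ, 0 < t → ∀ x : ℝ,
        Integrable (fun ξ : ℝ => (𝓕 f : Lp ℂ 2 (volume : Measure ℝ)) ξ *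
          FracSchrodinger.symbol a γ t (2 * Real.pi * ξ) *
          Complex.exp (2 * Real.pi * Complex.I * x * ξ))) ∧
      ∀ᵐ x : ℝ, Tendsto (fun t : ℝ => FracSchrodinger.opL2 a γ t f x) (𝓝[>] 0) (𝓝 (f x))) := by
  refine ⟨fun γ hγ hγ1 p hp hp' f => ⟨fun t ht x => ?_, ?_⟩,
    fun γ hγ s hs1 hs2 f hf => ⟨fun t ht x => ?_, ?_⟩⟩
  · exact FracSchrodinger.integrable_op ha0 ha1 ht hp hp' f x
  · exact FracSchrodinger.ae_tendsto_op ha0 ha1 hγ hγ1 hp hp' f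
  · exact FracSchrodinger.integrable_opL2 ha0 ht f x
  · exact FracSchrodinger.ae_tendsto_opL2 ha0 ha1 hγ hs1 hs2 f hf
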